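/- Fix an o-minimal structure on the ordered set $(\mathbb R,<)$; "definable" means definable in it with parameters, and all sets and maps below are definable. The empty set is regarded as connected. A coordinate cone in $\mathbb R^n$ is a set given by conditions $x_j\,\sigma_j\,c_j$ with $\sigma_j\in\{<,=,>\}$, $c_j\in\mathbb R$, at most one for each coordinate $x_j$. A definable open bounded set $X\subset\mathbb R^n$ is *semi-monotone* if $X\cap C$ is connected for every coordinate cone $C$. A bounded upper semi-continuous function $f$ on a non-empty semi-monotone set $X$ is *submonotone* if $\{\mathbf x\in X: f(\mathbf x)<b\}$ is semi-monotone for all $b\in\mathbb R$, and *supermonotone* if $-f$ is submonotone. A definable function $f$ on $X$ is *monotone* if it is both sub- and supermonotone and, for each $j$, it is strictly increasing in $x_j$, strictly decreasing in $x_j$, or independent of $x_j$ (these conditions comparing points of $X$ that differ only in the coordinate $x_j$). Let $\mathbf f=(f_1,\dots,f_k):X\to\mathbb R^k$ be a definable continuous bounded map on a non-empty semi-monotone set $X\subset\mathbb R^n$, $n\ge 1$, with graph $\mathbf F\subset\mathbb R^{n+k}=\operatorname{span}\{x_1,\dots,x_n,y_1,\dots,y_k\}$. A set $H\subset\{x_1,\dots,x_n,y_1,\dots,y_k\}$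 of exactly $n$ coordinates is a *basis set* of $\mathbf f$ if the map $X\to\mathbb R^n$ whose components are the $x_j$ with $x_j\in H$ and the $f_i$ with $y_i\in H$ is injective; the basis sets form the system $\mathbf m$ (matroid) associated with $\mathbf f$. The map $\mathbf f$ is *monotone*, by induction on $n$, if: for $n=1$, every $f_i$ is a monotone function; for $n\ge 2$, whenever $f_i$ is not independent of $x_j$, each non-empty set $\mathbf F\cap\{y_i=b\}$, $b\in\mathbb R$, considered in the space of all coordinates except $y_i$, is the graph of a monotone map $\mathbf f_{i,j,b}$ from a semi-monotone subset of $\operatorname{span}\{x_1,\dots,x_{j-1},x_{j+1},\dots,x_n\}$ to $\operatorname{span}\{y_1,\dots,y_{i-1},x_j,y_{i+1},\dots,y_k\}$, and the system of basis sets of $\mathbf f_{i,j,b}$ is the same for all these $b$. **Theorem.** Let $\mathbf f:X\to\mathbb R^k$ be a monotone map on a non-empty semi-monotone set $X\subset\mathbb R^n$, with graph $\mathbf F\subset\mathbb R^{n+k}$ and associated matroid $\mathbf m$. Let $H$ be a basis set of $\mathbf m$, let $T=\operatorname{span}(H)$, and let $\rho_T:\mathbf F\to T$ be the coordinate projection.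 Then $\rho_T(\mathbf F)\subset T$ is a semi-monotone set, and $\mathbf F$ is the graph of a monotone map from $\rho_T(\mathbf F)$ to the span of the $k$ coordinates not in $H$. -/

import Mathlib

universe u v

namespace MonotoneMaps

/-- An o-minimal structure on the ordered set of real numbers: a first-order structure on `ℝ`
in which the order is definable and every definable subset of `ℝ` is a finite union of points
and intervals.  (The order-connected subsets of `ℝ` are precisely the points and the bounded or
unbounded intervals, together with the empty set.)  "Definable" always means definable with
parameters from `ℝ`. -/
structure IsOMinimal (L : FirstOrder.Language.{u, v}) [L.Structure ℝ] : Prop where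
  definable_lt : (Set.univ : Set ℝ).Definable₂ L {p : ℝ × ℝ | p.1 < p.2}
  finite_union : ∀ s : Set ℝ, (Set.univ : Set ℝ).Definable₁ L s →
    ∃ T : Set (Set ℝ), T.Finite ∧ (∀ t ∈ T, t.OrdConnected) ∧ s = ⋃₀ T

/-- A coordinate cone in `ℝ^α`: at most one condition `x_j < c`, `x_j = c` or `x_j > c` for each
coordinate `x_j`. -/
def IsCoordinateCone {α : Type} (C : Set (α → ℝ)) : Prop :=
  ∃ (J : Finset α) (σ : α → Ordering) (c : α → ℝ),
    C = {x | ∀ j ∈ J, (σ j).Compares (x j) (c j)}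

/-- A (definable) semi-monotone set; the empty set counts as connected. -/
structure IsSemiMonotone (L : FirstOrder.Language.{u, v}) [L.Structure ℝ] {α : Type}
    (X : Set (α → ℝ)) : Prop where
  definable : (Set.univ : Set ℝ).Definable L X
  isOpen : IsOpen X
  bounded : Bornology.IsBounded X
  connected : ∀ C : Set (α → ℝ), IsCoordinateCone C → IsPreconnected (X ∩ C)

/-- The graph of the map `f : X → ℝ^β` as a subset of the space with coordinates
`x_a` (`Sum.inl a`) and `y_b` (`Sum.inr b`).  Here and below, a map on `X` is given by a total
function, of which only the values on `X` matter. -/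
def graph {α β : Type} (X : Set (α → ℝ)) (f : (α → ℝ) → (β → ℝ)) : Set (α ⊕ β → ℝ) :=
  {z | z ∘ Sum.inl ∈ X ∧ z ∘ Sum.inr = f (z ∘ Sum.inl)}

/-- `x` and `y` differ at most in the coordinate `j`. -/
def AgreeOff {α : Type} (j : α) (x y : α → ℝ) : Prop := ∀ l, l ≠ j → x l = y l

def StrictlyIncreasingIn {α : Type} (X : Set (α → ℝ)) (f : (α → ℝ) → ℝ) (j : α) : Prop :=
  ∀ x ∈ X, ∀ y ∈ X, AgreeOff j x y → x j < y j → f x < f y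

def StrictlyDecreasingIn {α : Type} (X : Set (α → ℝ)) (f : (α → ℝ) → ℝ) (j : α) : Prop :=
  ∀ x ∈ X, ∀ y ∈ X, AgreeOff j x y → x j < y j → f y < f x

def IndependentOf {α : Type} (X : Set (α → ℝ)) (f : (α → ℝ) → ℝ) (j : α) : Prop :=
  ∀ x ∈ X, ∀ y ∈ X, AgreeOff j x y → f x = f y

structure IsSubmonotone (L : FirstOrder.Language.{u, v}) [L.Structure ℝ] {α : Type}
    (X : Set (α → ℝ)) (f : (α → ℝ) → ℝ) : Prop where
  nonempty : X.Nonempty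
  domain : IsSemiMonotone L X
  bounded : Bornology.IsBounded (f '' X)
  upperSemicontinuous : UpperSemicontinuousOn f X
  sublevel : ∀ b : ℝ, IsSemiMonotone L {x | x ∈ X ∧ f x < b}

def IsSupermonotone (L : FirstOrder.Language.{u, v}) [L.Structure ℝ] {α : Type}
    (X : Set (α → ℝ)) (f : (α → ℝ) → ℝ) : Prop :=
  IsSubmonotone L X (fun x => - f x)

/-- A monotone (real-valued, definable) function on a non-empty semi-monotone set. -/
structure IsMonotoneFunction (L : FirstOrder.Language.{u, v}) [L.Structure ℝ] {α : Type}
    (X : Set (α → ℝ)) (f : (α → ℝ) → ℝ) : Prop where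
  definable : (Set.univ : Set ℝ).Definable L (graph X (fun x (_ : Unit) => f x))
  submonotone : IsSubmonotone L X f
  supermonotone : IsSupermonotone L X f
  coordinates : ∀ j : α,
    StrictlyIncreasingIn X f j ∨ StrictlyDecreasingIn X f j ∨ IndependentOf X f j

/-- The system of basis sets associated with `f : X → ℝ^β`, `X ⊆ ℝ^α`: the sets `H` of `|α|`
coordinates `x_a`, `y_b` such that the map on `X` whose components are the functions named by the
elements of `H` is injective. -/
def basisSystem {α β : Type} (X : Set (α → ℝ)) (f : (α → ℝ) → (β → ℝ)) :
    Set (Finset (α ⊕ β)) :=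
  {H | H.card = Nat.card α ∧
    Set.InjOn (fun (x : α → ℝ) (h : {c // c ∈ H}) => Sum.elim x (f x) h.1) X}

/-- The renaming of coordinates for the exchange of `x_j` and `y_i`: the coordinates
`x_a`, `a ≠ j`, keep their names, `x_j` takes the place of `y_i`, and the remaining `y_l` stay. -/
noncomputable def exchangeLabel {α β : Type} (i : β) (j : α) : {a : α // a ≠ j} ⊕ β → α ⊕ β :=
  open Classical in
  Sum.elim (fun a => Sum.inl a.1) (Function.update Sum.inr i (Sum.inl j))

/-- The set `F ∩ {y_i = b}`, considered as a set in the space with domain coordinates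
`x_a`, `a ≠ j`, and with value coordinates `y_l`, `l ≠ i`, and `x_j` (in the place of `y_i`). -/
def levelSlice {α β : Type} (F : Set (α ⊕ β → ℝ)) (i : β) (j : α) (b : ℝ) :
    Set ({a : α // a ≠ j} ⊕ β → ℝ) :=
  (fun z => z ∘ exchangeLabel i j) '' {z | z ∈ F ∧ z (Sum.inr i) = b}

/-- A (definable) continuous bounded map on a non-empty semi-monotone set. -/
structure IsBoundedContinuousMap (L : FirstOrder.Language.{u, v}) [L.Structure ℝ] {α β : Type}
    (X : Set (α → ℝ)) (f : (α → ℝ) → (β → ℝ)) : Prop where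
  nonempty : X.Nonempty
  domain : IsSemiMonotone L X
  definable : (Set.univ : Set ℝ).Definable L (graph X f)
  continuous : ContinuousOn f X
  bounded : Bornology.IsBounded (f '' X)

/-- Monotone maps on subsets of an `n`-dimensional coordinate space, by induction on `n ≥ 1`.
In the inductive step the common system `m` of basis sets expresses that the system of the map
whose graph is the level slice does not depend on `b`. -/
def IsMonotoneMapOfDim (L : FirstOrder.Language.{u, v}) [L.Structure ℝ] {β : Type} :
    ℕ → ∀ {α : Type}, Set (α → ℝ) → ((α → ℝ) → (β → ℝ)) → Prop
  | 0, _, _, _ => False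
  | 1, _, X, f =>
      IsBoundedContinuousMap L X f ∧ ∀ i : β, IsMonotoneFunction L X (fun x => f x i)
  | n + 2, α, X, f =>
      IsBoundedContinuousMap L X f ∧
      ∀ (i : β) (j : α), ¬ IndependentOf X (fun x => f x i) j →
        ∃ m : Set (Finset ({a : α // a ≠ j} ⊕ β)), ∀ b : ℝ,
          (levelSlice (graph X f) i j b).Nonempty →
          ∃ (X' : Set ({a : α // a ≠ j} → ℝ)) (f' : ({a : α // a ≠ j} → ℝ) → (β → ℝ)),
            IsMonotoneMapOfDim L (n + 1) X' f' ∧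
            graph X' f' = levelSlice (graph X f) i j b ∧
            basisSystem X' f' = m

/-- `f : X → ℝ^β`, `X ⊆ ℝ^α` non-empty and semi-monotone, is a monotone map. -/
def IsMonotoneMap (L : FirstOrder.Language.{u, v}) [L.Structure ℝ] {α β : Type}
    (X : Set (α → ℝ)) (f : (α → ℝ) → (β → ℝ)) : Prop :=
  IsMonotoneMapOfDim L (Nat.card α) X f

/-- The projection to `span I` of a set in a space with coordinates indexed by `γ`. -/
def proj {γ : Type} (I : Finset γ) (F : Set (γ → ℝ)) : Set ({c // c ∈ I} → ℝ) :=
  (fun z c => z c.1) '' F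

end MonotoneMaps

/-!
Forget which coordinates are the arguments: a *chart* over a set `S` of coordinates is a set that
projects homeomorphically to an open subset of `span S` and meets every coordinate cone of `span S`
in a connected set.  The theorem says that a monotone chart over `S` is a monotone chart over every
basis set.

If `x_i` varies along `x_j`, `j ∈ S`, on a monotone chart, then the level sets of `x_i` are charts
over `S \ {j}`, so that `i` can take the place of `j`: the implicit function theorem for monotone
functions of one variable makes the new projection open, and connectedness follows by fibering over
`x_i`, an open map with connected fibers.  That the new chart is monotone follows by induction on
the dimension, as its level sets arise by exchanges in level sets of the old one; these level sets
have constant basis systems, hence vary along the right coordinates at every level.  For a basis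
set `H` and `i ∈ H \ S`, there is `j ∈ S \ H` along which `x_i` varies, and the exchange of `j` for
`i` decreases `H \ S`; so `H` is reached from `S` by finitely many exchanges.
-/

namespace MonotoneMaps

open Set Filter Topology

section Topology

variable {E B : Type*} [TopologicalSpace E] [TopologicalSpace B]

lemma isPreconnected_inter_preimage {Z : Set E} {φ : E → B}
    (hopen : ∀ z ∈ Z, 𝓝 (φ z) ≤ map φ (𝓝[Z] z)) {T : Set B} (hT : IsPreconnected T)
    (hTZ : T ⊆ φ '' Z) (hfib : ∀ t ∈ T, IsPreconnected (Z ∩ φ ⁻¹' {t})) :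
    IsPreconnected (Z ∩ φ ⁻¹' T) := by
  have isOpen_image {u : Set E} (hu : IsOpen u) : IsOpen (φ '' (Z ∩ u)) := by
    rw [isOpen_iff_mem_nhds]
    rintro _ ⟨z, ⟨hzZ, hzu⟩, rfl⟩
    exact hopen z hzZ (image_mem_map (inter_mem_nhdsWithin Z (hu.mem_nhds hzu)))
  rintro u v hu hv huv ⟨x, ⟨hxZ, hxT⟩, hxu⟩ ⟨y, ⟨hyZ, hyT⟩, hyv⟩
  have hcover : T ⊆ φ '' (Z ∩ u) ∪ φ '' (Z ∩ v) := fun t ht => by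
    obtain ⟨z, hz, rfl⟩ := hTZ ht
    exact (huv ⟨hz, ht⟩).imp (fun h => ⟨z, ⟨hz, h⟩, rfl⟩) fun h => ⟨z, ⟨hz, h⟩, rfl⟩
  obtain ⟨t, ht, ⟨x', ⟨hxZ', hxu'⟩, hxt⟩, y', ⟨hyZ', hyv'⟩, hyt⟩ :=
    hT _ _ (isOpen_image hu) (isOpen_image hv) hcover
      ⟨φ x, hxT, x, ⟨hxZ, hxu⟩, rfl⟩ ⟨φ y, hyT, y, ⟨hyZ, hyv⟩, rfl⟩
  have hsub : Z ∩ φ ⁻¹' {t} ⊆ Z ∩ φ ⁻¹' T :=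
    inter_subset_inter_right Z (preimage_mono (singleton_subset_iff.2 ht))
  obtain ⟨z, hz, hzuv⟩ := hfib t ht u v hu hv (hsub.trans huv)
    ⟨x', ⟨hxZ', hxt⟩, hxu'⟩ ⟨y', ⟨hyZ', hyt⟩, hyv'⟩
  exact ⟨z, hsub hz, hzuv⟩

lemma exists_lt_lt_of_injOn_Icc {φ : ℝ → ℝ} {a b t : ℝ} (ht : t ∈ Ioo a b)
    (hφ : ContinuousOn φ (Icc a b)) (hinj : InjOn φ (Icc a b)) :
    ∃ c ∈ Icc a b, ∃ d ∈ Icc a b, φ c < φ t ∧ φ t < φ d := by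
  have hab : a ≤ b := (ht.1.trans ht.2).le
  have ha := left_mem_Icc.2 hab
  have hb := right_mem_Icc.2 hab
  have ht' := Ioo_subset_Icc_self ht
  rcases hφ.strictMonoOn_of_injOn_Icc' hab hinj with hmono | hanti
  · exact ⟨a, ha, b, hb, hmono ha ht' ht.1, hmono ht' hb ht.2⟩
  · exact ⟨b, hb, a, ha, hanti ht' hb ht.2, hanti ha ht' ht.1⟩

/- A change of sign of `G (a, ·) - G (a, t₀)` between `c` and `d` persists for nearby parameters
and values, so that the intermediate value theorem yields the solution. -/
lemma eventually_exists_eq_of_injOn {G : E × ℝ → ℝ} {V : Set (E × ℝ)} {a : E} {t₀ : ℝ}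
    (hV : V ∈ 𝓝 (a, t₀)) (hG : ContinuousOn G V)
    (hinj : InjOn (fun t => G (a, t)) {t | (a, t) ∈ V}) :
    ∀ᶠ q in 𝓝 (a, G (a, t₀)), ∃ t, (q.1, t) ∈ V ∧ G (q.1, t) = q.2 := by
  obtain ⟨A, hA, B, hB, hAB⟩ := mem_nhds_prod_iff.1 hV
  obtain ⟨δ, hδ, hI⟩ := Metric.nhds_basis_closedBall.mem_iff.1 hB
  rw [Real.closedBall_eq_Icc] at hI
  set I := Icc (t₀ - δ) (t₀ + δ)
  have hmem {x t} (hx : x ∈ A) (ht : t ∈ I) : (x, t) ∈ V := hAB ⟨hx, hI ht⟩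
  have hline {x} (hx : x ∈ A) : ContinuousOn (fun t => G (x, t)) I :=
    hG.comp (Continuous.prodMk_right x).continuousOn fun _ => hmem hx
  have ha : a ∈ A := mem_of_mem_nhds hA
  obtain ⟨c, hc, d, hd, hlt, hgt⟩ := exists_lt_lt_of_injOn_Icc
    (show t₀ ∈ Ioo (t₀ - δ) (t₀ + δ) by constructor <;> linarith) (hline ha)
    (hinj.mono fun t => hmem ha)
  have hfst : Tendsto Prod.fst (𝓝 (a, G (a, t₀))) (𝓝 a) := continuous_fst.tendsto _
  have hsnd : Tendsto Prod.snd (𝓝 (a, G (a, t₀))) (𝓝 (G (a, t₀))) := continuous_snd.tendsto _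
  have tendsto_G {s} (hs : s ∈ I) :
      Tendsto (fun q : E × ℝ => G (q.1, s)) (𝓝 (a, G (a, t₀))) (𝓝 (G (a, s))) :=
    ((hG.comp (Continuous.prodMk_left s).continuousOn fun _ hx => hmem hx hs).continuousAt
      hA).tendsto.comp hfst
  filter_upwards [hfst hA, (tendsto_G hc).eventually_lt hsnd hlt,
    hsnd.eventually_lt (tendsto_G hd) hgt] with q hq hqc hqd
  obtain ⟨t, ht, hqt⟩ := isPreconnected_Icc.intermediate_value hc hd (hline hq) ⟨hqc.le, hqd.le⟩
  exact ⟨t, hmem hq ht, hqt⟩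

/- Otherwise `v = φ ∘ u` on `Y`, where `φ` has equal values at two points and so, by Rolle's
argument, an extremum at some `u y`; but then `y` is an extremum of `v` on `Y`. -/
lemma eq_of_eq_of_nhds_le_map {Y : Set E} (hY : IsPreconnected Y) {u v : E → ℝ}
    (hu : ContinuousOn u Y) (hv : ContinuousOn v Y)
    (hu_open : ∀ y ∈ Y, 𝓝 (u y) ≤ map u (𝓝[Y] y)) (hv_open : ∀ y ∈ Y, 𝓝 (v y) ≤ map v (𝓝[Y] y))
    (huv : ∀ y ∈ Y, ∀ z ∈ Y, u y = u z → v y = v z) {a b : E} (ha : a ∈ Y) (hb : b ∈ Y)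
    (hab : v a = v b) : u a = u b := by
  obtain ⟨φ, hφ⟩ : ∃ φ : ℝ → ℝ, ∀ y ∈ Y, φ (u y) = v y := by
    have hfactors : (Y.domRestrict v).FactorsThrough (Y.domRestrict u) :=
      fun y z => huv y y.2 z z.2
    obtain ⟨φ, hφ⟩ := (Function.factorsThrough_iff _).1 hfactors
    exact ⟨φ, fun y hy => (congrFun hφ ⟨y, hy⟩).symm⟩
  have map_v (y : E) : map v (𝓝[Y] y) = map φ (map u (𝓝[Y] y)) := by
    rw [map_map]
    exact map_congr (eventually_nhdsWithin_of_forall fun z hz => (hφ z hz).symm)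
  by_contra hne
  wlog hlt : u a < u b generalizing a b
  · exact this hb ha hab.symm (Ne.symm hne) (lt_of_le_of_ne (not_lt.1 hlt) (Ne.symm hne))
  have hIcc : Icc (u a) (u b) ⊆ u '' Y :=
    (hY.image u hu).ordConnected.out (mem_image_of_mem u ha) (mem_image_of_mem u hb)
  have hφc : ContinuousOn φ (Icc (u a) (u b)) := fun x hx => by
    obtain ⟨y, hy, rfl⟩ := hIcc hx
    refine ContinuousAt.continuousWithinAt ?_
    calc map φ (𝓝 (u y)) ≤ map φ (map u (𝓝[Y] y)) := map_mono (hu_open y hy)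
      _ = map v (𝓝[Y] y) := (map_v y).symm
      _ ≤ 𝓝 (v y) := hv y hy
      _ = 𝓝 (φ (u y)) := by rw [hφ y hy]
  obtain ⟨x, hx, hext⟩ := exists_isLocalExtr_Ioo hlt hφc
    (by rw [hφ a ha, hφ b hb, hab])
  obtain ⟨y, hy, rfl⟩ := hIcc (Ioo_subset_Icc_self hx)
  have hle : 𝓝 (φ (u y)) ≤ map φ (𝓝 (u y)) := calc
    𝓝 (φ (u y)) = 𝓝 (v y) := by rw [hφ y hy]
    _ ≤ map v (𝓝[Y] y) := hv_open y hy
    _ = map φ (map u (𝓝[Y] y)) := map_v y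
    _ ≤ map φ (𝓝 (u y)) := map_mono (hu y hy)
  exact hext.elim (fun hmin => hmin.on univ |>.not_nhds_le_map (by rwa [nhdsWithin_univ]))
    fun hmax => hmax.on univ |>.not_nhds_le_map (by rwa [nhdsWithin_univ])

end Topology

section Charts

variable {γ : Type*} {S T H K : Finset γ} {F G : Set (γ → ℝ)} {p : γ → ℝ} {i j : γ} {b : ℝ}

/-- The points of `F` are determined by their coordinates in `H`. -/
def Separates (H : Finset γ) (F : Set (γ → ℝ)) : Prop :=
  ∀ z ∈ F, ∀ w ∈ F, EqOn z w H → z = w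

/-- The section of `F` by the hyperplane `x_i = b`, in the same ambient space as `F`. -/
def level (F : Set (γ → ℝ)) (i : γ) (b : ℝ) : Set (γ → ℝ) := {z ∈ F | z i = b}

/-- The fiber through `p` of the projection of `F` to `span T`. -/
def fiber (T : Finset γ) (F : Set (γ → ℝ)) (p : γ → ℝ) : Set (γ → ℝ) := {z ∈ F | EqOn z p T}

/-- The coordinate cone given by the conditions `x_j σ_j c_j`, `j ∈ J`. -/
def cone (J : Finset γ) (σ : γ → Ordering) (c : γ → ℝ) : Set (γ → ℝ) :=
  {x | ∀ j ∈ J, (σ j).Compares (x j) (c j)}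

/-- The projection of `F` to `span S` is open.  Points of `span S` are represented by arbitrary
points of the ambient space, of which only the coordinates in `S` matter. -/
def IsOpenOver (S : Finset γ) (F : Set (γ → ℝ)) : Prop :=
  ∀ z ∈ F, ∀ U ∈ 𝓝 z, ∀ᶠ x in 𝓝 z, ∃ w ∈ F ∩ U, EqOn w x S

/-- The preimage in the ambient space of the projection of `F` to `span S`. -/
def cylinder (S : Finset γ) (F : Set (γ → ℝ)) : Set (γ → ℝ) := {x | ∃ w ∈ F, EqOn w x S}

/-- A point of `F` over the projection of `x` to `span S`; junk unless `x ∈ cylinder S F`. -/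
noncomputable def lift (S : Finset γ) (F : Set (γ → ℝ)) (x : γ → ℝ) : γ → ℝ :=
  Classical.epsilon fun w => w ∈ F ∧ EqOn w x S

/-- A coordinate-free version of the graph of a continuous map on a semi-monotone subset of
`span S`: `F` projects homeomorphically to an open subset of `span S`, and its intersections with
coordinate cones of `span S` are connected. -/
structure IsChart (S : Finset γ) (F : Set (γ → ℝ)) : Prop where
  nonempty : F.Nonempty
  separates : Separates S F
  isOpenOver : IsOpenOver S F
  connected : ∀ (J : Finset γ) (σ : γ → Ordering) (c : γ → ℝ), J ⊆ S →
    IsPreconnected (F ∩ cone J σ c)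

lemma Separates.mono (h : Separates H F) (hG : G ⊆ F) : Separates H G :=
  fun z hz w hw => h z (hG hz) w (hG hw)

lemma Separates.superset (h : Separates H F) (hHK : H ⊆ K) : Separates K F :=
  fun z hz w hw hzw => h z hz w hw (hzw.mono hHK)

lemma level_subset (F : Set (γ → ℝ)) (i : γ) (b : ℝ) : level F i b ⊆ F := fun _ h => h.1

lemma level_comm (F : Set (γ → ℝ)) (i j : γ) (b c : ℝ) :
    level (level F i b) j c = level (level F j c) i b := by
  ext z
  exact and_right_comm

lemma lift_mem {x : γ → ℝ} (hx : x ∈ cylinder S F) : lift S F x ∈ F :=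
  (Classical.epsilon_spec hx).1

lemma eqOn_lift {x : γ → ℝ} (hx : x ∈ cylinder S F) : EqOn (lift S F x) x S :=
  (Classical.epsilon_spec hx).2

lemma Separates.lift_eq (h : Separates S F) {w x : γ → ℝ} (hw : w ∈ F) (hwx : EqOn w x S) :
    lift S F x = w :=
  h _ (lift_mem ⟨w, hw, hwx⟩) _ hw ((eqOn_lift ⟨w, hw, hwx⟩).trans hwx.symm)

lemma IsOpenOver.eventually_exists (h : IsOpenOver S F) {w x : γ → ℝ} (hw : w ∈ F)
    (hwx : EqOn w x S) {U : Set (γ → ℝ)} (hU : U ∈ 𝓝 w) :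
    ∀ᶠ y in 𝓝 x, ∃ w' ∈ F ∩ U, EqOn w' y S := by
  classical
  have htendsto : Tendsto (fun y => S.piecewise y w) (𝓝 x) (𝓝 w) := by
    have hcont : Continuous fun y : γ → ℝ => S.piecewise y w := continuous_pi fun c => by
      by_cases hc : c ∈ S
      · simpa only [Finset.piecewise, hc, if_true] using continuous_apply c
      · simpa only [Finset.piecewise, hc, if_false] using continuous_const
    have hxw : S.piecewise x w = w :=
      (S.piecewise_congr (fun c hc => (hwx hc).symm) fun _ _ => rfl).trans (S.piecewise_same w)
    simpa only [hxw] using hcont.tendsto x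
  filter_upwards [htendsto.eventually (h w hw U hU)] with y ⟨w', hw', hwy⟩
  exact ⟨w', hw', fun c hc => (hwy hc).trans (S.piecewise_eq_of_mem y w hc)⟩

lemma IsOpenOver.cylinder_inter_mem_nhds (h : IsOpenOver S F) (hS : Separates S F) {x : γ → ℝ}
    (hx : x ∈ cylinder S F) {U : Set (γ → ℝ)} (hU : U ∈ 𝓝 (lift S F x)) :
    cylinder S F ∩ lift S F ⁻¹' U ∈ 𝓝 x := by
  filter_upwards [h.eventually_exists (lift_mem hx) (eqOn_lift hx) hU] with y ⟨w, hw, hwy⟩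
  exact ⟨⟨w, hw.1, hwy⟩, by rw [mem_preimage, hS.lift_eq hw.1 hwy]; exact hw.2⟩

lemma IsOpenOver.continuousOn_lift (h : IsOpenOver S F) (hS : Separates S F) :
    ContinuousOn (lift S F) (cylinder S F) := fun _ hx =>
  ContinuousAt.continuousWithinAt fun _ hU => mem_map.2 <|
    mem_of_superset (h.cylinder_inter_mem_nhds hS hx hU) inter_subset_right

lemma IsChart.isPreconnected_fiber (h : IsChart S F) (hT : T ⊆ S) (p : γ → ℝ) :
    IsPreconnected (fiber T F p) :=
  h.connected T (fun _ => Ordering.eq) p hT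

variable [DecidableEq γ]

/-- The coordinate `i` is not constant along the coordinate `j ∈ S`, the other coordinates in `S`
being fixed. -/
def VariesAlong (S : Finset γ) (F : Set (γ → ℝ)) (i j : γ) : Prop :=
  ∃ z ∈ F, ∃ w ∈ F, EqOn z w (S.erase j) ∧ z i ≠ w i

/- The implicit function theorem for the coordinate `i` as a function of the coordinate `j`, the
other coordinates in `S` being parameters. -/
lemma IsOpenOver.exchange (h : IsOpenOver S F) (hS : Separates S F) (hj : j ∈ S)
    (hij : Separates (insert i (S.erase j)) F) : IsOpenOver (insert i (S.erase j)) F := by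
  intro p hp U hU
  let m : (γ → ℝ) × ℝ → γ → ℝ := fun q => Function.update q.1 j q.2
  have hm : Continuous m := continuous_fst.update j continuous_snd
  have eqOn_lift_erase {q} (hq : m q ∈ cylinder S F) : EqOn (lift S F (m q)) q.1 (S.erase j) :=
    fun c hc => (eqOn_lift hq (Finset.mem_of_mem_erase hc)).trans
      (Function.update_of_ne (Finset.ne_of_mem_erase hc) _ _)
  have lift_apply {q} (hq : m q ∈ cylinder S F) : lift S F (m q) j = q.2 :=
    (eqOn_lift hq hj).trans (Function.update_self j _ _)
  have hmp : m (p, p j) = p := Function.update_eq_self j p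
  have hpS : p ∈ cylinder S F := ⟨p, hp, fun _ _ => rfl⟩
  have hlift : lift S F p = p := hS.lift_eq hp fun _ _ => rfl
  have hsolve := eventually_exists_eq_of_injOn (G := fun q => lift S F (m q) i)
    (V := m ⁻¹' (cylinder S F ∩ lift S F ⁻¹' U)) (a := p) (t₀ := p j)
    (hm.continuousAt.preimage_mem_nhds <| by
      rw [hmp]
      exact h.cylinder_inter_mem_nhds hS hpS (by rwa [hlift]))
    ((continuous_apply i).comp_continuousOn
      ((h.continuousOn_lift hS).comp hm.continuousOn fun _ hq => hq.1))
    fun t ht t' ht' heq => by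
      have hlifts : lift S F (m (p, t)) = lift S F (m (p, t')) := by
        refine hij _ (lift_mem ht.1) _ (lift_mem ht'.1) fun c hc => ?_
        rcases Finset.mem_insert.1 hc with rfl | hc
        · exact heq
        · exact (eqOn_lift_erase ht.1 hc).trans (eqOn_lift_erase ht'.1 hc).symm
      exact (lift_apply ht.1).symm.trans ((congrFun hlifts j).trans (lift_apply ht'.1))
  simp only [hmp, hlift] at hsolve
  have hgraph : Tendsto (fun x : γ → ℝ => (x, x i)) (𝓝 p) (𝓝 (p, p i)) :=
    (continuous_id.prodMk (continuous_apply i)).tendsto p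
  filter_upwards [hgraph.eventually hsolve] with x ⟨t, ⟨hcyl, hU⟩, hxi⟩
  refine ⟨_, ⟨lift_mem hcyl, hU⟩, fun c hc => ?_⟩
  rcases Finset.mem_insert.1 hc with rfl | hc
  · exact hxi
  · exact eqOn_lift_erase hcyl hc

lemma IsOpenOver.nhds_le_map (h : IsOpenOver (insert i T) F) (hi : i ∉ T) (hp : p ∈ F) :
    𝓝 (p i) ≤ map (fun z => z i) (𝓝[fiber T F p] p) := by
  intro A hA
  obtain ⟨U, hU, hUA⟩ := mem_nhdsWithin_iff_exists_mem_nhds_inter.1 hA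
  have hupdate : Tendsto (Function.update p i) (𝓝 (p i)) (𝓝 p) := by
    have hcont : Continuous (Function.update p i) := continuous_const.update i continuous_id
    simpa only [Function.update_eq_self] using hcont.tendsto (p i)
  filter_upwards [hupdate.eventually (h p hp U hU)] with t ⟨w, hw, hwt⟩
  have hwi : w i = t := (hwt (Finset.mem_insert_self i T)).trans (Function.update_self i t p)
  have hwT : EqOn w p T := fun c hc => (hwt (Finset.mem_insert_of_mem hc)).trans
    (Function.update_of_ne (ne_of_mem_of_not_mem hc hi) t p)
  exact hwi ▸ hUA ⟨hw.2, hw.1, hwT⟩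

lemma IsOpenOver.exists_apply_ne (h : IsOpenOver (insert i T) F) (hi : i ∉ T) (hp : p ∈ F) :
    ∃ q ∈ fiber T F p, q i ≠ p i := by
  by_contra! hconst
  have hmem : {p i} ∈ 𝓝 (p i) := h.nhds_le_map hi hp (eventually_nhdsWithin_of_forall hconst)
  exact infinite_of_mem_nhds (p i) hmem (finite_singleton (p i))

lemma IsOpenOver.level (h : IsOpenOver S F) (hj : j ∈ S) :
    IsOpenOver (S.erase j) (level F j b) := by
  intro z hz U hU
  have hupdate : Tendsto (fun x => Function.update x j b) (𝓝 z) (𝓝 z) := by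
    have hzj : Function.update z j b = z := hz.2 ▸ Function.update_eq_self j z
    have hcont : Continuous fun x : γ → ℝ => Function.update x j b :=
      continuous_id.update j continuous_const
    simpa only [hzj] using hcont.tendsto z
  filter_upwards [hupdate.eventually (h z hz.1 U hU)] with x ⟨w, hw, hwx⟩
  exact ⟨w, ⟨⟨hw.1, (hwx hj).trans (Function.update_self j b x)⟩, hw.2⟩, fun c hc =>
    (hwx (Finset.mem_of_mem_erase hc)).trans
      (Function.update_of_ne (Finset.ne_of_mem_erase hc) b x)⟩

lemma ordConnected_setOf_compares {A : Type*} [PartialOrder A] (o : Ordering) (a : A) :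
    {t | o.Compares t a}.OrdConnected := by
  cases o
  exacts [ordConnected_Iio, ordConnected_singleton, ordConnected_Ioi]

lemma cone_eq_of_mem {J : Finset γ} {σ : γ → Ordering} {c : γ → ℝ} (hi : i ∈ J) :
    cone J σ c = cone (J.erase i) σ c ∩ {x | (σ i).Compares (x i) (c i)} := by
  nth_rewrite 1 [← Finset.insert_erase hi]
  ext x
  exact (Finset.forall_mem_insert _ _ _).trans and_comm

namespace IsChart

lemma not_separates_erase (h : IsChart S F) (hj : j ∈ S) : ¬ Separates (S.erase j) F := by
  intro hsep
  obtain ⟨p, hp⟩ := h.nonempty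
  obtain ⟨q, ⟨hq, hqp⟩, hne⟩ := IsOpenOver.exists_apply_ne
    ((Finset.insert_erase hj).symm ▸ h.isOpenOver) (S.notMem_erase j) hp
  exact hne (congrFun (hsep q hq p hp hqp) j)

lemma notMem_erase_of_separates (h : IsChart S F) (hj : j ∈ S)
    (hij : Separates (insert i (S.erase j)) F) : i ∉ S.erase j := fun hi =>
  h.not_separates_erase hj (Finset.insert_eq_of_mem hi ▸ hij)

lemma nhds_le_map_fiber (h : IsChart S F) (hj : j ∈ S)
    (hij : Separates (insert i (S.erase j)) F) {z : γ → ℝ} (hz : z ∈ F) :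
    𝓝 (z i) ≤ map (fun x => x i) (𝓝[fiber (S.erase j) F z] z) :=
  (h.isOpenOver.exchange h.separates hj hij).nhds_le_map (h.notMem_erase_of_separates hj hij) hz

lemma variesAlong_of_separates (h : IsChart S F) (hj : j ∈ S)
    (hij : Separates (insert i (S.erase j)) F) : VariesAlong S F i j := by
  obtain ⟨p, hp⟩ := h.nonempty
  obtain ⟨q, ⟨hq, hqp⟩, hne⟩ := (h.isOpenOver.exchange h.separates hj hij).exists_apply_ne
    (h.notMem_erase_of_separates hj hij) hp
  exact ⟨q, hq, p, hp, hqp, hne⟩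

lemma eq_of_eq_of_separates (h : IsChart S F) {u v : γ} (hj : j ∈ S) (hT : T ⊆ S.erase j)
    (hu : Separates (insert u (S.erase j)) F) (hv : Separates (insert v (S.erase j)) F)
    (huv : ∀ z ∈ fiber T F p, ∀ w ∈ fiber T F p, z u = w u → z v = w v)
    {a b : γ → ℝ} (ha : a ∈ fiber T F p) (hb : b ∈ fiber T F p) (hab : a v = b v) :
    a u = b u := by
  have hfiber {z} (hz : z ∈ fiber T F p) : fiber (S.erase j) F z ⊆ fiber T F p := fun w hw =>
    ⟨hw.1, (hw.2.mono hT).trans hz.2⟩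
  exact eq_of_eq_of_nhds_le_map (h.isPreconnected_fiber (hT.trans (S.erase_subset j)) p)
    (continuous_apply u).continuousOn (continuous_apply v).continuousOn
    (fun z hz => (h.nhds_le_map_fiber hj hu hz.1).trans (map_mono (nhdsWithin_mono z (hfiber hz))))
    (fun z hz => (h.nhds_le_map_fiber hj hv hz.1).trans (map_mono (nhdsWithin_mono z (hfiber hz))))
    huv ha hb hab

lemma eq_of_forall_not_variesAlong (h : IsChart S F) (hT : ∀ j ∈ T, ¬ VariesAlong S F i j)
    {a b : γ → ℝ} (ha : a ∈ F) (hb : b ∈ F) (hab : EqOn a b ↑(S \ T)) : a i = b i := by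
  induction T using Finset.induction_on generalizing a b with
  | empty =>
    rw [Finset.sdiff_empty] at hab
    rw [h.separates a ha b hb hab]
  | insert d T _ ih =>
    rw [Finset.forall_mem_insert] at hT
    set Y := fiber (S \ insert d T) F b
    have hloc : ∀ y ∈ Y, ∀ᶠ z in 𝓝[Y] y, z i = y i := fun y hy => by
      have hupdate : Tendsto (fun z : γ → ℝ => Function.update y d (z d)) (𝓝 y) (𝓝 y) := by
        have hcont : Continuous fun z : γ → ℝ => Function.update y d (z d) :=
          continuous_const.update d (continuous_apply d)
        simpa only [Function.update_eq_self] using hcont.tendsto y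
      filter_upwards [self_mem_nhdsWithin, nhdsWithin_le_nhds
        (hupdate.eventually (h.isOpenOver y hy.1 univ univ_mem))] with z hz ⟨w, ⟨hw, _⟩, hwy⟩
      have hwy_erase : EqOn w y (S.erase d) := fun c hc =>
        (hwy (Finset.mem_of_mem_erase hc)).trans
          (Function.update_of_ne (Finset.ne_of_mem_erase hc) _ y)
      have hzw : EqOn z w ↑(S \ T) := fun c hc => by
        obtain ⟨hcS, hcT⟩ := Finset.mem_sdiff.1 hc
        rcases eq_or_ne c d with rfl | hcd
        · exact ((hwy hcS).trans (Function.update_self c _ y)).symm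
        · have hc' : c ∈ S \ insert d T := by simp [hcS, hcT, hcd]
          exact ((hz.2 hc').trans (hy.2 hc').symm).trans
            (hwy_erase (Finset.mem_erase.2 ⟨hcd, hcS⟩)).symm
      have hwy_i : w i = y i := by
        by_contra hne
        exact hT.1 ⟨w, hw, y, hy.1, hwy_erase, hne⟩
      exact (ih hT.2 hz.1 hw hzw).trans hwy_i
    exact ((h.isPreconnected_fiber Finset.sdiff_subset b).induction₂ (fun y z => z i = y i) hloc
      (fun _ _ _ _ _ _ hxy hyz => hyz.trans hxy) (fun _ _ _ _ hxy => hxy.symm)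
      ⟨hb, fun _ _ => rfl⟩ ⟨ha, hab⟩)

lemma level (h : IsChart S F) (hj : j ∈ S) (hne : (level F j b).Nonempty) :
    IsChart (S.erase j) (level F j b) where
  nonempty := hne
  separates z hz w hw hzw := h.separates z hz.1 w hw.1 fun c hc => by
    rcases eq_or_ne c j with rfl | hcj
    · exact hz.2.trans hw.2.symm
    · exact hzw (Finset.mem_erase.2 ⟨hcj, hc⟩)
  isOpenOver := h.isOpenOver.level hj
  connected J σ c hJ := by
    have hjJ : ∀ i ∈ J, i ≠ j := fun i hi => Finset.ne_of_mem_erase (hJ hi)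
    have hcone : MonotoneMaps.level F j b ∩ cone J σ c = F ∩ cone (insert j J)
        (Function.update σ j Ordering.eq) (Function.update c j b) := by
      ext x
      simp +contextual [MonotoneMaps.level, cone, hjJ, and_assoc]
    rw [hcone]
    exact h.connected _ _ _ (Finset.insert_subset hj (hJ.trans (S.erase_subset j)))

lemma exchange (h : IsChart S F) (hj : j ∈ S) (hij : Separates (insert i (S.erase j)) F)
    (hlevel : ∀ b, (MonotoneMaps.level F i b).Nonempty →
      IsChart (S.erase j) (MonotoneMaps.level F i b)) :
    IsChart (insert i (S.erase j)) F where
  nonempty := h.nonempty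
  separates := hij
  isOpenOver := h.isOpenOver.exchange h.separates hj hij
  connected J σ c hJ := by
    have hJi : J.erase i ⊆ S.erase j := Finset.subset_insert_iff.1 hJ
    set Z := F ∩ cone (J.erase i) σ c
    have hZ : IsPreconnected Z := h.connected _ σ c (hJi.trans (S.erase_subset j))
    by_cases hi : i ∈ J
    swap
    · rwa [← Finset.erase_eq_of_notMem hi]
    have hfiber {z} (hz : z ∈ Z) : fiber (S.erase j) F z ⊆ Z := fun x hx =>
      ⟨hx.1, fun k hk => by rw [hx.2 (hJi hk)]; exact hz.2 k hk⟩
    set T := {t | (σ i).Compares t (c i)}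
    have hT : IsPreconnected ((fun z => z i) '' Z ∩ T) :=
      ((hZ.image _ (continuous_apply i).continuousOn).ordConnected.inter
        (ordConnected_setOf_compares _ _)).isPreconnected
    have hcone : F ∩ cone J σ c = Z ∩ (fun z => z i) ⁻¹' ((fun z => z i) '' Z ∩ T) := by
      rw [cone_eq_of_mem hi, ← inter_assoc]
      ext x
      exact ⟨fun hx => ⟨hx.1, mem_image_of_mem _ hx.1, hx.2⟩, fun hx => ⟨hx.1, hx.2.2⟩⟩
    rw [hcone]
    refine isPreconnected_inter_preimage (fun z hz => (h.nhds_le_map_fiber hj hij hz.1).trans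
      (map_mono (nhdsWithin_mono z (hfiber hz)))) hT inter_subset_left ?_
    rintro t ⟨⟨z, hz, hzt⟩, -⟩
    have hlevel_inter : Z ∩ (fun z => z i) ⁻¹' {t} =
        MonotoneMaps.level F i t ∩ cone (J.erase i) σ c := inter_right_comm _ _ _
    rw [hlevel_inter]
    exact (hlevel t ⟨z, hz.1, hzt⟩).connected _ σ c hJi

end IsChart

end Charts

section MonotoneCharts

variable {γ : Type*} [DecidableEq γ] {S H K : Finset γ} {F : Set (γ → ℝ)} {i j l c : γ} {b : ℝ}

lemma separates_insert_iff : Separates (insert i H) F ↔ ∀ b, Separates H (level F i b) := by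
  refine ⟨fun h b z hz w hw hzw => h z hz.1 w hw.1 ?_, fun h z hz w hw hzw =>
    h (w i) z ⟨hz, hzw (Finset.mem_insert_self i H)⟩ w ⟨hw, rfl⟩
      (hzw.mono (Finset.subset_insert i H))⟩
  rw [Finset.coe_insert]
  rintro c (rfl | hc)
  exacts [hz.2.trans hw.2.symm, hzw hc]

lemma Separates.erase_level (h : Separates H F) (i : γ) (b : ℝ) :
    Separates (H.erase i) (level F i b) :=
  separates_insert_iff.1 (h.superset (H.subset_insert_iff.2 subset_rfl)) b

lemma Separates.erase_of_const (h : Separates H F) (hconst : ∀ z ∈ F, z i = b) :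
    Separates (H.erase i) F :=
  (h.erase_level i b).mono fun z hz => ⟨hz, hconst z hz⟩

lemma eqOn_erase_of_level {z w : γ → ℝ} (hz : z ∈ level F i b) (hw : w ∈ level F i b)
    (hzw : EqOn z w (S.erase i)) : EqOn z w S := by
  intro c hc
  rcases eq_or_ne c i with rfl | hci
  · exact hz.2.trans hw.2.symm
  · exact hzw (Finset.mem_erase.2 ⟨hci, hc⟩)

lemma VariesAlong.of_level (h : VariesAlong (S.erase c) (level F c b) i j) :
    VariesAlong S F i j := by
  obtain ⟨z, hz, w, hw, hzw, hne⟩ := h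
  rw [Finset.erase_right_comm] at hzw
  exact ⟨z, hz.1, w, hw.1, eqOn_erase_of_level hz hw hzw, hne⟩

lemma VariesAlong.ne_of_level {T : Finset γ} (h : VariesAlong T (level F c b) i j) : i ≠ c := by
  obtain ⟨z, hz, w, hw, -, hne⟩ := h
  rintro rfl
  exact hne (hz.2.trans hw.2.symm)

lemma VariesAlong.eq_of_mem (h : VariesAlong S F i j) (hi : i ∈ S) : i = j := by
  obtain ⟨z, -, w, -, hzw, hne⟩ := h
  by_contra hij
  exact hne (hzw (Finset.mem_erase.2 ⟨hij, hi⟩))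

lemma IsChart.variesAlong_of_level (h : IsChart S F) (hj : j ∈ S)
    (hij : Separates (insert i (S.erase j)) F)
    (hjl : VariesAlong (S.erase j) (MonotoneMaps.level F i b) j l) : VariesAlong S F i l := by
  obtain ⟨z, hz, w, hw, hzw, hne⟩ := hjl
  by_contra hil
  refine hne (h.eq_of_eq_of_separates hj ((S.erase j).erase_subset l)
    ((Finset.insert_erase hj).symm ▸ h.separates) hij (p := w) (fun x hx y hy hxy => ?_)
    ⟨hz.1, hzw⟩ ⟨hw.1, fun _ _ => rfl⟩ (hz.2.trans hw.2.symm))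
  by_contra hne'
  refine hil ⟨x, hx.1, y, hy.1, eqOn_erase_of_level (i := j) ⟨hx.1, hxy⟩ ⟨hy.1, rfl⟩ ?_, hne'⟩
  rw [Finset.erase_right_comm]
  exact hx.2.trans hy.2.symm

lemma IsChart.exists_variesAlong_level (h : IsChart S F) (hj : j ∈ S)
    (hij : Separates (insert i (S.erase j)) F) (hcj : Separates (insert c (S.erase j)) F)
    (hl : l ∈ S.erase j) (hcl : VariesAlong (insert i (S.erase j)) F c l) :
    ∃ b, VariesAlong (S.erase j) (MonotoneMaps.level F c b) i l := by
  obtain ⟨z, hz, w, hw, hzw, hne⟩ := hcl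
  have hil : i ≠ l := fun hil => h.notMem_erase_of_separates hj hij (hil ▸ hl)
  rw [Finset.erase_insert_of_ne hil] at hzw
  by_contra! hconst
  refine hne (h.eq_of_eq_of_separates hj ((S.erase j).erase_subset l) hcj hij (p := w)
    (fun x hx y hy hxy => ?_)
    ⟨hz, hzw.mono (Finset.coe_subset.2 (Finset.subset_insert _ _))⟩ ⟨hw, fun _ _ => rfl⟩
    (hzw (Finset.mem_insert_self _ _)))
  by_contra hne'
  exact hconst (y c) ⟨x, ⟨hx.1, hxy⟩, y, ⟨hy.1, rfl⟩, hx.2.trans hy.2.symm, hne'⟩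

lemma IsChart.variesAlong_of_not_variesAlong (h : IsChart S F) (hcj : ¬ VariesAlong S F c j)
    (hcl : VariesAlong (insert i (S.erase j)) F c l) : VariesAlong S F c l := by
  obtain ⟨z, hz, w, hw, hzw, hne⟩ := hcl
  by_contra hcl
  refine hne (h.eq_of_forall_not_variesAlong (T := {j, l}) (by simp [hcj, hcl]) hz hw
    fun k hk => hzw ?_)
  simp only [Finset.coe_sdiff, Finset.coe_insert, Finset.coe_singleton, Set.mem_sdiff,
    Finset.mem_coe, mem_insert_iff, mem_singleton_iff, not_or] at hk
  simp [hk.1, hk.2.1, hk.2.2]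

lemma IsChart.variesAlong_level_of_not_variesAlong (h : IsChart S F) (hj : j ∈ S)
    (hij : Separates (insert i (S.erase j)) F) (hcj : ¬ VariesAlong S F c j)
    (hb : (MonotoneMaps.level F c b).Nonempty) :
    VariesAlong (S.erase l) (MonotoneMaps.level F c b) i j := by
  obtain ⟨p, hp, hpb⟩ := hb
  obtain ⟨q, ⟨hq, hqp⟩, hne⟩ := (h.isOpenOver.exchange h.separates hj hij).exists_apply_ne
    (h.notMem_erase_of_separates hj hij) hp
  have hqb : q c = b := by
    by_contra hqb
    exact hcj ⟨q, hq, p, hp, hqp, hpb ▸ hqb⟩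
  refine ⟨q, ⟨hq, hqb⟩, p, ⟨hp, hpb⟩, hqp.mono ?_, hne⟩
  rw [Finset.erase_right_comm]
  exact_mod_cast Finset.erase_subset _ _

/-- A coordinate-free version of the graph of a monotone map on a subset of `span S`: a chart
whose level sets in the dependent coordinates are again monotone charts, with basis sets
independent of the level. -/
inductive IsMonotoneChart : Finset γ → Set (γ → ℝ) → Prop
  | mk {S : Finset γ} {F : Set (γ → ℝ)} (isChart : IsChart S F)
      (level : ∀ i ∉ S, ∀ j ∈ S, VariesAlong S F i j → ∀ b, (level F i b).Nonempty →
        IsMonotoneChart (S.erase j) (level F i b))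
      (separates_level : ∀ i ∉ S, ∀ j ∈ S, VariesAlong S F i j → ∀ H : Finset γ,
        H.card = (S.erase j).card → ∀ b b', (MonotoneMaps.level F i b).Nonempty →
        Separates H (MonotoneMaps.level F i b) → Separates H (MonotoneMaps.level F i b')) :
    IsMonotoneChart S F

/-- The level set `x_j = b`, `j ∈ S`, is a monotone chart, the basis sets of which are those of the
contraction by `j` of the matroid of `F`. -/
structure IsContractibleAt (S : Finset γ) (F : Set (γ → ℝ)) (j : γ) (b : ℝ) : Prop where
  isMonotoneChart : IsMonotoneChart (S.erase j) (level F j b)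
  separates_insert : ∀ H : Finset γ, H.card = (S.erase j).card → Separates H (level F j b) →
    Separates (insert j H) F

namespace IsMonotoneChart

lemma isChart (h : IsMonotoneChart S F) : IsChart S F := by
  cases h; assumption

lemma level_of_notMem (h : IsMonotoneChart S F) (hi : i ∉ S) (hj : j ∈ S)
    (hij : VariesAlong S F i j) (hb : (level F i b).Nonempty) :
    IsMonotoneChart (S.erase j) (level F i b) := by
  cases h with | mk _ level _ => exact level i hi j hj hij b hb

lemma separates_level_of_notMem (h : IsMonotoneChart S F) (hi : i ∉ S) (hj : j ∈ S)
    (hij : VariesAlong S F i j) (hcard : H.card = (S.erase j).card) (hb : (level F i b).Nonempty)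
    (hH : Separates H (level F i b)) (b' : ℝ) : Separates H (level F i b') := by
  cases h with | mk _ _ separates_level => exact separates_level i hi j hj hij H hcard b b' hb hH

lemma separates_exchange (h : IsMonotoneChart S F) (hj : j ∈ S) (hij : VariesAlong S F i j) :
    Separates (insert i (S.erase j)) F := by
  by_cases hi : i ∈ S
  · rw [hij.eq_of_mem hi, Finset.insert_erase hj]
    exact h.isChart.separates
  · exact separates_insert_iff.2 fun b z hz =>
      (h.level_of_notMem hi hj hij ⟨z, hz⟩).isChart.separates z hz

lemma card_le (h : IsMonotoneChart S F) (hH : Separates H F) : S.card ≤ H.card := by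
  induction h generalizing H with
  | @mk S F hchart _ _ ih =>
    obtain ⟨p, hp⟩ := hchart.nonempty
    by_cases hvar : ∃ i ∈ H, i ∉ S ∧ ∃ j ∈ S, VariesAlong S F i j
    · obtain ⟨i, hiH, hiS, j, hj, hij⟩ := hvar
      have hle := ih i hiS j hj hij (p i) ⟨p, hp, rfl⟩ (hH.erase_level i (p i))
      rw [← Finset.card_erase_add_one hj, ← Finset.card_erase_add_one hiH]
      exact Nat.add_le_add_right hle 1
    · push Not at hvar
      refine Finset.card_le_card fun j hj => ?_
      by_contra hjH
      refine hchart.not_separates_erase hj fun z hz w hw hzw => hH z hz w hw fun c hc => ?_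
      by_cases hcS : c ∈ S
      · exact hzw (Finset.mem_erase.2 ⟨ne_of_mem_of_not_mem hc hjH, hcS⟩)
      · exact hchart.eq_of_forall_not_variesAlong (hvar c hc hcS) hz hw (by simp)

lemma not_separates_erase (h : IsMonotoneChart S F) (hcard : H.card = S.card) (hi : i ∈ H) :
    ¬ Separates (H.erase i) F := fun hsep =>
  (hcard ▸ Finset.card_erase_lt_of_mem hi).not_ge (h.card_le hsep)

lemma notMem_of_const (h : IsMonotoneChart S F) (hH : Separates H F) (hcard : H.card = S.card)
    (hconst : ∀ z ∈ F, z i = b) : i ∉ H := fun hi =>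
  h.not_separates_erase hcard hi (hH.erase_of_const hconst)

lemma exists_variesAlong_of_mem (h : IsMonotoneChart S F) (hH : Separates H F)
    (hcard : H.card = S.card) (hi : i ∈ H) : ∃ j ∈ S, VariesAlong S F i j := by
  by_contra! hconst
  obtain ⟨p, hp⟩ := h.isChart.nonempty
  exact h.notMem_of_const hH hcard (fun z hz =>
    h.isChart.eq_of_forall_not_variesAlong (T := S) hconst hz hp (by simp)) hi

lemma exists_variesAlong_notMem (h : IsMonotoneChart S F) (hH : Separates H F)
    (hcard : H.card = S.card) (hiH : i ∈ H) (hiS : i ∉ S) :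
    ∃ l ∈ S, l ∉ H ∧ VariesAlong S F i l := by
  induction h generalizing H i with
  | @mk S F hchart hlevel hbasis ih =>
    have h := IsMonotoneChart.mk hchart hlevel hbasis
    obtain ⟨j, hj, hij⟩ := h.exists_variesAlong_of_mem hH hcard hiH
    by_cases hjH : j ∈ H
    swap
    · exact ⟨j, hj, hjH, hij⟩
    obtain ⟨p, hp⟩ := hchart.nonempty
    obtain ⟨l, hl, hlH, hjl⟩ := ih i hiS j hj hij (p i) ⟨p, hp, rfl⟩ (hH.erase_level i (p i))
      (by rw [Finset.card_erase_of_mem hiH, Finset.card_erase_of_mem hj, hcard])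
      (Finset.mem_erase.2 ⟨ne_of_mem_of_not_mem hj hiS, hjH⟩) (S.notMem_erase j)
    have hlS := Finset.mem_of_mem_erase hl
    exact ⟨l, hlS, fun hm => hlH (Finset.mem_erase.2 ⟨ne_of_mem_of_not_mem hlS hiS, hm⟩),
      hchart.variesAlong_of_level hj (h.separates_exchange hj hij) hjl⟩

lemma separates_insert_level (h : IsMonotoneChart S F) (hj : j ∈ S) (hi : i ∉ S.erase j)
    (hl : l ∈ S.erase j) (hil : VariesAlong (S.erase j) (level F j b) i l) {a : ℝ}
    (hcontract : IsContractibleAt (S.erase l) (level F i a) j b)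
    (ha : (level (level F j b) i a).Nonempty) (hcard : H.card = ((S.erase j).erase l).card)
    (hH : Separates H (level (level F j b) i a)) (a' : ℝ) :
    Separates (insert j H) (level F i a') := by
  rw [Finset.erase_right_comm] at hcard
  rw [level_comm] at ha hH
  have hjH : j ∉ H := hcontract.isMonotoneChart.notMem_of_const hH hcard fun _ hz => hz.2
  refine h.separates_level_of_notMem (fun hiS => hi (Finset.mem_erase.2 ⟨hil.ne_of_level, hiS⟩))
    (Finset.mem_of_mem_erase hl) hil.of_level ?_ (ha.mono (level_subset _ _ _))
    (hcontract.separates_insert H hcard hH) a'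
  rw [Finset.card_insert_of_notMem hjH, hcard, Finset.card_erase_add_one
    (Finset.mem_erase.2 ⟨(Finset.ne_of_mem_erase hl).symm, hj⟩)]

lemma isContractibleAt (h : IsMonotoneChart S F) (hj : j ∈ S) (hb : (level F j b).Nonempty) :
    IsContractibleAt S F j b := by
  induction h generalizing j b with
  | @mk S F hchart hlevel hbasis ih =>
    have h := IsMonotoneChart.mk hchart hlevel hbasis
    have hcontract {i l a} (hi : i ∉ S.erase j) (hl : l ∈ S.erase j)
        (hil : VariesAlong (S.erase j) (MonotoneMaps.level F j b) i l)
        (ha : (MonotoneMaps.level (MonotoneMaps.level F j b) i a).Nonempty) :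
        IsContractibleAt (S.erase l) (MonotoneMaps.level F i a) j b := by
      rw [level_comm] at ha
      exact ih i (fun hiS => hi (Finset.mem_erase.2 ⟨hil.ne_of_level, hiS⟩)) l
        (Finset.mem_of_mem_erase hl) hil.of_level a (ha.mono (level_subset _ _ _))
        (Finset.mem_erase.2 ⟨(Finset.ne_of_mem_erase hl).symm, hj⟩) ha
    have hmono : IsMonotoneChart (S.erase j) (MonotoneMaps.level F j b) := by
      refine ⟨hchart.level hj hb, fun i hi l hl hil a ha => ?_,
        fun i hi l hl hil H hcard a a' ha hH => ?_⟩
      · rw [level_comm, Finset.erase_right_comm]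
        exact (hcontract hi hl hil ha).isMonotoneChart
      · rw [level_comm]
        exact separates_insert_iff.1
          (h.separates_insert_level hj hi hl hil (hcontract hi hl hil ha) ha hcard hH a') b
    refine ⟨hmono, fun H hcard hH => ?_⟩
    by_cases hsub : H ⊆ S.erase j
    · rw [Finset.eq_of_subset_of_card_le hsub hcard.ge, Finset.insert_erase hj]
      exact hchart.separates
    · obtain ⟨i, hiH, hi⟩ := Finset.not_subset.1 hsub
      obtain ⟨l, hl, hil⟩ := hmono.exists_variesAlong_of_mem hH hcard hiH
      obtain ⟨p, hp⟩ := hb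
      have hcard_erase : (H.erase i).card = ((S.erase j).erase l).card := by
        rw [Finset.card_erase_of_mem hiH, Finset.card_erase_of_mem hl, hcard]
      have ha : (MonotoneMaps.level (MonotoneMaps.level F j b) i (p i)).Nonempty := ⟨p, hp, rfl⟩
      refine (separates_insert_iff.2 (h.separates_insert_level hj hi hl hil
        (hcontract hi hl hil ha) ha hcard_erase (hH.erase_level i (p i)))).superset ?_
      rw [Finset.insert_comm, Finset.insert_erase hiH]

protected lemma level (h : IsMonotoneChart S F) (hj : j ∈ S) (hcj : VariesAlong S F c j)
    (hb : (level F c b).Nonempty) : IsMonotoneChart (S.erase j) (level F c b) := by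
  by_cases hc : c ∈ S
  · obtain rfl := hcj.eq_of_mem hc
    exact (h.isContractibleAt hc hb).isMonotoneChart
  · exact h.level_of_notMem hc hj hcj hb

lemma separates_level (h : IsMonotoneChart S F) (hj : j ∈ S) (hcj : VariesAlong S F c j)
    (hcard : H.card = (S.erase j).card) (hb : (MonotoneMaps.level F c b).Nonempty)
    (hH : Separates H (MonotoneMaps.level F c b)) (b' : ℝ) :
    Separates H (MonotoneMaps.level F c b') := by
  by_cases hc : c ∈ S
  · obtain rfl := hcj.eq_of_mem hc
    exact separates_insert_iff.1 ((h.isContractibleAt hc hb).separates_insert H hcard hH) b'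
  · exact h.separates_level_of_notMem hc hj hcj hcard hb hH b'

lemma isChart_exchange (h : IsMonotoneChart S F) (hj : j ∈ S) (hij : VariesAlong S F i j) :
    IsChart (insert i (S.erase j)) F :=
  h.isChart.exchange hj (h.separates_exchange hj hij) fun _ hb => (h.level hj hij hb).isChart

lemma variesAlong_level (h : IsMonotoneChart S F) (hj : j ∈ S) (hij : VariesAlong S F i j)
    (hcj : VariesAlong S F c j) (hl : l ∈ S.erase j)
    (hcl : VariesAlong (insert i (S.erase j)) F c l) (hb : (MonotoneMaps.level F c b).Nonempty) :
    VariesAlong (S.erase j) (MonotoneMaps.level F c b) i l := by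
  have hi : i ∉ S.erase j :=
    h.isChart.notMem_erase_of_separates hj (h.separates_exchange hj hij)
  obtain ⟨b₀, hil⟩ := h.isChart.exists_variesAlong_level hj (h.separates_exchange hj hij)
    (h.separates_exchange hj hcj) hl hcl
  have hb₀ : (MonotoneMaps.level F c b₀).Nonempty := let ⟨z, hz, _⟩ := hil; ⟨z, hz⟩
  refine (h.level hj hcj hb).isChart.variesAlong_of_separates hl
    (h.separates_level hj hcj ?_ hb₀ ((h.level hj hcj hb₀).separates_exchange hl hil) b)
  rw [Finset.card_insert_of_notMem fun hm => hi (Finset.mem_of_mem_erase hm),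
    Finset.card_erase_add_one hl]

/- If `c` varies along `j`, then `i` is exchanged for `l` in a level set of `c` over `S.erase j`;
otherwise `i` is exchanged for `j` in a level set of `c` over `S.erase l`. -/
lemma level_exchange (h : IsMonotoneChart S F)
    (ih : ∀ T ⊂ S, ∀ {G : Set (γ → ℝ)} {a k : γ}, IsMonotoneChart T G → k ∈ T →
      VariesAlong T G a k → IsMonotoneChart (insert a (T.erase k)) G)
    (hj : j ∈ S) (hij : VariesAlong S F i j) (hl : l ∈ insert i (S.erase j))
    (hcl : VariesAlong (insert i (S.erase j)) F c l) (hb : (MonotoneMaps.level F c b).Nonempty) :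
    IsMonotoneChart ((insert i (S.erase j)).erase l) (MonotoneMaps.level F c b) := by
  have hij_sep := h.separates_exchange hj hij
  have hi : i ∉ S.erase j := h.isChart.notMem_erase_of_separates hj hij_sep
  rcases eq_or_ne l i with rfl | hli
  · have hcj : VariesAlong S F c j := by rwa [VariesAlong, Finset.erase_insert hi] at hcl
    rw [Finset.erase_insert hi]
    exact h.level hj hcj hb
  have hl : l ∈ S.erase j := Finset.mem_of_mem_insert_of_ne hl hli
  obtain ⟨hlj, hlS⟩ := Finset.mem_erase.1 hl
  rw [Finset.erase_insert_of_ne hli.symm]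
  by_cases hcj : VariesAlong S F c j
  · exact ih _ (Finset.erase_ssubset hj) (h.level hj hcj hb) hl
      (h.variesAlong_level hj hij hcj hl hcl hb)
  · have hcl_S : VariesAlong S F c l := h.isChart.variesAlong_of_not_variesAlong hcj hcl
    rw [Finset.erase_right_comm]
    exact ih _ (Finset.erase_ssubset hlS) (h.level hlS hcl_S hb)
      (Finset.mem_erase.2 ⟨hlj.symm, hj⟩)
      (h.isChart.variesAlong_level_of_not_variesAlong hj hij_sep hcj hb)

theorem exchange (h : IsMonotoneChart S F) (hj : j ∈ S) (hij : VariesAlong S F i j) :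
    IsMonotoneChart (insert i (S.erase j)) F := by
  induction S using Finset.strongInduction generalizing F i j with
  | H S ih =>
    refine ⟨h.isChart_exchange hj hij, fun c _ l hl hcl b hb =>
      h.level_exchange (fun T hT G a k hG hk => ih T hT hG hk) hj hij hl hcl hb,
      fun c _ l hl hcl H hcard b b' hb hH => ?_⟩
    obtain ⟨k, hk, hck⟩ : ∃ k ∈ S, VariesAlong S F c k := by
      by_contra! hconst
      obtain ⟨z, hz, w, hw, -, hne⟩ := hcl
      exact hne (h.isChart.eq_of_forall_not_variesAlong hconst hz hw (by simp))
    refine h.separates_level hk hck ?_ hb hH b'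
    rw [hcard, Finset.card_erase_of_mem hl, Finset.card_erase_of_mem hk,
      Finset.card_insert_of_notMem (h.isChart.notMem_erase_of_separates hj
        (h.separates_exchange hj hij)), Finset.card_erase_add_one hj]

theorem of_separates (h : IsMonotoneChart S F) (hH : Separates H F) (hcard : H.card = S.card) :
    IsMonotoneChart H F := by
  induction hm : (H \ S).card using Nat.strong_induction_on generalizing S with
  | _ m ih =>
    by_cases hsub : H ⊆ S
    · rwa [Finset.eq_of_subset_of_card_le hsub hcard.ge]
    obtain ⟨i, hiH, hiS⟩ := Finset.not_subset.1 hsub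
    obtain ⟨l, hl, hlH, hil⟩ := h.exists_variesAlong_notMem hH hcard hiH hiS
    have hi : i ∉ S.erase l := fun hi => hiS (Finset.mem_of_mem_erase hi)
    have hlt : H \ insert i (S.erase l) ⊂ H \ S := by
      refine (Finset.ssubset_iff_of_subset fun k hk => ?_).2 ⟨i, by simp [hiH, hiS], by simp⟩
      obtain ⟨hkH, hk⟩ := Finset.mem_sdiff.1 hk
      refine Finset.mem_sdiff.2 ⟨hkH, fun hkS => hk (Finset.mem_insert_of_mem ?_)⟩
      exact Finset.mem_erase.2 ⟨ne_of_mem_of_not_mem hkH hlH, hkS⟩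
    refine ih _ (hm ▸ Finset.card_lt_card hlt) (h.exchange hl hil) ?_ rfl
    rw [Finset.card_insert_of_notMem hi, Finset.card_erase_add_one hl, hcard]

end IsMonotoneChart

end MonotoneCharts

section Labeling

variable {α β γ δ : Type} {e : α ⊕ β → γ} {S : Finset γ} {F : Set (γ → ℝ)}

/-- The `x`-coordinates of a point of a space whose coordinates `x_a`, `y_b` are named by `e`. -/
def fstPart (e : α ⊕ β → γ) (z : γ → ℝ) : α → ℝ := fun a => z (e (Sum.inl a))

/-- The `y`-coordinates of a point of a space whose coordinates `x_a`, `y_b` are named by `e`. -/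
def sndPart (e : α ⊕ β → γ) (z : γ → ℝ) : β → ℝ := fun b => z (e (Sum.inr b))

/-- The coordinates relevant for `F` are named `x_a`, `y_b` by `e`, the coordinates in `S` being the
`x_a`.  The remaining coordinates are constant on `F`; they arise from passing to level sets, which
stay in the ambient space of `F`. -/
structure IsLabeling (e : α ⊕ β → γ) (S : Finset γ) (F : Set (γ → ℝ)) : Prop where
  injective : Function.Injective e
  mem_iff : ∀ c, c ∈ S ↔ ∃ a, e (Sum.inl a) = c
  constant : ∀ c ∉ range e, ∀ z ∈ F, ∀ w ∈ F, z c = w c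

/-- `F` is the graph of `f : X → ℝ^β`, its coordinates being named by `e`. -/
structure Realizes (e : α ⊕ β → γ) (S : Finset γ) (F : Set (γ → ℝ)) (X : Set (α → ℝ))
    (f : (α → ℝ) → (β → ℝ)) : Prop extends IsLabeling e S F where
  image_eq : (fun z => z ∘ e) '' F = graph X f

lemma continuous_fstPart : Continuous (fstPart e) := continuous_pi fun _ => continuous_apply _

lemma continuous_sndPart : Continuous (sndPart e) := continuous_pi fun _ => continuous_apply _

lemma continuous_extend (ι : δ → γ) (z : γ → ℝ) :
    Continuous fun x : δ → ℝ => Function.extend ι x z := continuous_pi fun c => by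
  by_cases hc : ∃ d, ι d = c
  · simp only [Function.extend, dif_pos hc]
    exact continuous_apply _
  · simp only [Function.extend, dif_neg hc]
    exact continuous_const

lemma isBounded_image_comp {F : Set (γ → ℝ)} (hF : Bornology.IsBounded F) (ι : δ → γ) :
    Bornology.IsBounded ((fun z => z ∘ ι) '' F) := by
  rw [← Bornology.forall_isBounded_image_eval_iff] at hF ⊢
  intro d
  rw [image_image]
  exact hF (ι d)

lemma exchangeLabel_eq_swap_comp [DecidableEq (α ⊕ β)] (i : β) (j : α) :
    exchangeLabel i j = Equiv.swap (Sum.inl j) (Sum.inr i) ∘ Sum.map Subtype.val id := by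
  funext c
  rcases c with a | l
  · have ha : (Sum.inl a.1 : α ⊕ β) ≠ Sum.inl j := fun h => a.2 (Sum.inl_injective h)
    exact (Equiv.swap_apply_of_ne_of_ne ha Sum.inl_ne_inr).symm
  · rcases eq_or_ne l i with rfl | hl
    · simp [exchangeLabel]
    · simp [exchangeLabel, hl, Equiv.swap_apply_of_ne_of_ne]

lemma exchangeLabel_injective (i : β) (j : α) : Function.Injective (exchangeLabel i j) := by
  classical
  rw [exchangeLabel_eq_swap_comp]
  exact (Equiv.injective _).comp
    (Sum.map_injective.2 ⟨Subtype.val_injective, Function.injective_id⟩)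

lemma range_exchangeLabel (i : β) (j : α) : range (exchangeLabel i j) = {Sum.inr i}ᶜ := by
  classical
  have hmap : range (Sum.map (Subtype.val : {a : α // a ≠ j} → α) (id : β → β)) =
      {Sum.inl j}ᶜ := by
    ext (a | b) <;> simp
  rw [exchangeLabel_eq_swap_comp, range_comp, hmap, image_compl_eq (Equiv.bijective _),
    image_singleton, Equiv.swap_apply_left]

namespace IsLabeling

lemma inl_mem (h : IsLabeling e S F) (j : α) : e (Sum.inl j) ∈ S := (h.mem_iff _).2 ⟨j, rfl⟩

lemma inr_notMem (h : IsLabeling e S F) (i : β) : e (Sum.inr i) ∉ S := fun hi =>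
  let ⟨_, ha⟩ := (h.mem_iff _).1 hi
  Sum.inl_ne_inr (h.injective ha)

lemma injective_comp_inl (h : IsLabeling e S F) : Function.Injective (e ∘ Sum.inl) :=
  h.injective.comp Sum.inl_injective

lemma card_eq (h : IsLabeling e S F) : S.card = Nat.card α := by
  have hrange : (S : Set γ) = range (e ∘ Sum.inl) := Set.ext h.mem_iff
  rw [← Nat.card_eq_finsetCard, ← Nat.card_range_of_injective h.injective_comp_inl, ← hrange]
  rfl

lemma eqOn_iff (h : IsLabeling e S F) {z w : γ → ℝ} :
    EqOn z w S ↔ fstPart e z = fstPart e w := by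
  refine ⟨fun hzw => funext fun a => hzw (h.inl_mem a), fun hzw c hc => ?_⟩
  obtain ⟨a, rfl⟩ := (h.mem_iff c).1 hc
  exact congrFun hzw a

lemma subset_range (h : IsLabeling e S F) {H : Finset γ}
    (hconst : ∀ c ∈ H, ∀ b, ¬ ∀ z ∈ F, z c = b) : (H : Set γ) ⊆ range e := by
  intro c hc
  by_contra hce
  rcases F.eq_empty_or_nonempty with rfl | ⟨p, hp⟩
  · exact hconst c hc 0 fun _ => False.elim
  · exact hconst c hc (p c) fun z hz => h.constant c hce z hz p hp

lemma exchange [DecidableEq γ] (h : IsLabeling e S F) (i : β) (j : α) (b : ℝ) :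
    IsLabeling (e ∘ exchangeLabel i j) (S.erase (e (Sum.inl j))) (level F (e (Sum.inr i)) b) where
  injective := h.injective.comp (exchangeLabel_injective i j)
  mem_iff c := by
    rw [Finset.mem_erase, h.mem_iff]
    constructor
    · rintro ⟨hne, a, rfl⟩
      exact ⟨⟨a, fun ha => hne (ha ▸ rfl)⟩, rfl⟩
    · rintro ⟨a, rfl⟩
      exact ⟨fun ha => a.2 (h.injective_comp_inl ha), a, rfl⟩
  constant c hc z hz w hw := by
    by_cases hce : c ∈ range e
    · obtain ⟨d, rfl⟩ := hce
      obtain rfl : d = Sum.inr i := by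
        rw [range_comp, range_exchangeLabel, h.injective.mem_set_image] at hc
        exact not_not.1 hc
      exact hz.2.trans hw.2.symm
    · exact h.constant c hce z hz.1 w hw.1

lemma exists_realizes (h : IsLabeling e S F) (hS : Separates S F) :
    ∃ f : (α → ℝ) → (β → ℝ), Realizes e S F (fstPart e '' F) f := by
  have hinj : InjOn (fstPart e) F := fun z hz w hw hzw => hS z hz w hw (h.eqOn_iff.2 hzw)
  have hinv := hinj.leftInvOn_invFunOn
  refine ⟨sndPart e ∘ Function.invFunOn (fstPart e) F, h, ?_⟩
  ext y
  constructor
  · rintro ⟨z, hz, rfl⟩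
    exact ⟨⟨z, hz, rfl⟩, congrArg (sndPart e) (hinv hz).symm⟩
  · rintro ⟨⟨z, hz, hzy⟩, hy⟩
    refine ⟨z, hz, funext ?_⟩
    rintro (a | b)
    · exact congrFun hzy a
    · have hyz : y ∘ Sum.inr = sndPart e z := by
        rw [hy, ← hzy, Function.comp_apply, hinv hz]
      exact (congrFun hyz b).symm

end IsLabeling

end Labeling

section Realization

variable {α β γ : Type} {e : α ⊕ β → γ} {S : Finset γ} {F : Set (γ → ℝ)} {X : Set (α → ℝ)}
  {f : (α → ℝ) → (β → ℝ)} {L : FirstOrder.Language.{u, v}} [L.Structure ℝ]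

namespace Realizes

lemma fstPart_mem (R : Realizes e S F X f) {z : γ → ℝ} (hz : z ∈ F) : fstPart e z ∈ X :=
  (R.image_eq.le ⟨z, hz, rfl⟩).1

lemma sndPart_eq (R : Realizes e S F X f) {z : γ → ℝ} (hz : z ∈ F) :
    sndPart e z = f (fstPart e z) :=
  (R.image_eq.le ⟨z, hz, rfl⟩).2

lemma exists_mem (R : Realizes e S F X f) {x : α → ℝ} (hx : x ∈ X) :
    ∃ z ∈ F, fstPart e z = x := by
  obtain ⟨z, hz, hzx⟩ := R.image_eq.ge (show Sum.elim x (f x) ∈ graph X f from ⟨hx, rfl⟩)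
  exact ⟨z, hz, funext fun a => congrFun hzx (Sum.inl a)⟩

lemma image_fstPart (R : Realizes e S F X f) : fstPart e '' F = X :=
  Subset.antisymm (image_subset_iff.2 fun _ => R.fstPart_mem) fun _ => R.exists_mem

lemma image_sndPart (R : Realizes e S F X f) : sndPart e '' F = f '' X := by
  rw [← R.image_fstPart, image_image]
  exact image_congr fun z hz => R.sndPart_eq hz

lemma elim_eq_comp (R : Realizes e S F X f) {z : γ → ℝ} (hz : z ∈ F) :
    Sum.elim (fstPart e z) (f (fstPart e z)) = z ∘ e := by
  rw [← R.sndPart_eq hz]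
  exact Sum.elim_comp_inl_inr (z ∘ e)

lemma separates (R : Realizes e S F X f) : Separates S F := by
  intro z hz w hw hzw
  funext c
  by_cases hc : c ∈ range e
  · obtain ⟨d, rfl⟩ := hc
    exact congrFun ((R.elim_eq_comp hz).symm.trans
      ((R.eqOn_iff.1 hzw) ▸ R.elim_eq_comp hw)) d
  · exact R.constant c hc z hz w hw

lemma nonempty_iff (R : Realizes e S F X f) : F.Nonempty ↔ X.Nonempty := by
  rw [← R.image_fstPart, image_nonempty]

lemma image_inter_cone [DecidableEq γ] (R : Realizes e S F X f) (J : Finset α)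
    (σ : γ → Ordering) (c : γ → ℝ) :
    fstPart e '' (F ∩ cone (J.image (e ∘ Sum.inl)) σ c) =
      X ∩ cone J (σ ∘ e ∘ Sum.inl) (c ∘ e ∘ Sum.inl) := by
  have hcone : cone (J.image (e ∘ Sum.inl)) σ c =
      fstPart e ⁻¹' cone J (σ ∘ e ∘ Sum.inl) (c ∘ e ∘ Sum.inl) :=
    Set.ext fun _ => Finset.forall_mem_image
  rw [hcone, image_inter_preimage, R.image_fstPart]

lemma eqOn_erase_iff [DecidableEq γ] (R : Realizes e S F X f) {j : α} {z w : γ → ℝ} :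
    EqOn z w (S.erase (e (Sum.inl j))) ↔ AgreeOff j (fstPart e z) (fstPart e w) := by
  constructor
  · exact fun h a ha => h (Finset.mem_erase.2 ⟨R.injective_comp_inl.ne ha, R.inl_mem a⟩)
  · intro h c hc
    obtain ⟨hne, hc⟩ := Finset.mem_erase.1 hc
    obtain ⟨a, rfl⟩ := (R.mem_iff c).1 hc
    exact h a fun ha => hne (ha ▸ rfl)

lemma apply_inr (R : Realizes e S F X f) {z : γ → ℝ} (hz : z ∈ F) (i : β) :
    z (e (Sum.inr i)) = f (fstPart e z) i :=
  congrFun (R.sndPart_eq hz) i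

lemma variesAlong_iff [DecidableEq γ] (R : Realizes e S F X f) {i : β} {j : α} :
    VariesAlong S F (e (Sum.inr i)) (e (Sum.inl j)) ↔ ¬ IndependentOf X (fun x => f x i) j := by
  constructor
  · rintro ⟨z, hz, w, hw, hzw, hne⟩ hind
    rw [R.apply_inr hz, R.apply_inr hw] at hne
    exact hne (hind _ (R.fstPart_mem hz) _ (R.fstPart_mem hw) (R.eqOn_erase_iff.1 hzw))
  · intro hind
    simp only [IndependentOf, not_forall] at hind
    obtain ⟨x, hx, y, hy, hxy, hne⟩ := hind
    obtain ⟨z, hz, rfl⟩ := R.exists_mem hx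
    obtain ⟨w, hw, rfl⟩ := R.exists_mem hy
    exact ⟨z, hz, w, hw, R.eqOn_erase_iff.2 hxy, by rwa [R.apply_inr hz, R.apply_inr hw]⟩

lemma exists_inr_eq_of_variesAlong [DecidableEq γ] (R : Realizes e S F X f) {c d : γ}
    (hc : c ∉ S) (hcd : VariesAlong S F c d) : ∃ i, e (Sum.inr i) = c := by
  obtain ⟨z, hz, w, hw, -, hne⟩ := hcd
  obtain ⟨a | i, rfl⟩ := not_imp_comm.1 (R.constant c) fun h => hne (h z hz w hw)
  · exact absurd (R.inl_mem a) hc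
  · exact ⟨i, rfl⟩

lemma separates_singleton_iff (R : Realizes e S F X f) {i : β} :
    Separates {e (Sum.inr i)} F ↔ InjOn (fun x => f x i) X := by
  simp only [Separates, Finset.coe_singleton, eqOn_singleton]
  constructor
  · intro h x hx y hy hxy
    obtain ⟨z, hz, rfl⟩ := R.exists_mem hx
    obtain ⟨w, hw, rfl⟩ := R.exists_mem hy
    rw [h z hz w hw (by rw [R.apply_inr hz, R.apply_inr hw]; exact hxy)]
  · intro h z hz w hw hzw
    rw [R.apply_inr hz, R.apply_inr hw] at hzw
    exact R.separates z hz w hw (R.eqOn_iff.2 (h (R.fstPart_mem hz) (R.fstPart_mem hw) hzw))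

lemma levelSlice_eq (R : Realizes e S F X f) (i : β) (j : α) (b : ℝ) :
    levelSlice (graph X f) i j b =
      (fun z => z ∘ (e ∘ exchangeLabel i j)) '' level F (e (Sum.inr i)) b := by
  rw [levelSlice, ← R.image_eq]
  ext y
  constructor
  · rintro ⟨_, ⟨⟨z, hz, rfl⟩, hb⟩, rfl⟩
    exact ⟨z, ⟨hz, hb⟩, rfl⟩
  · rintro ⟨z, ⟨hz, hb⟩, rfl⟩
    exact ⟨z ∘ e, ⟨⟨z, hz, rfl⟩, hb⟩, rfl⟩

lemma exchange [DecidableEq γ] (R : Realizes e S F X f) {i : β} {j : α} {b : ℝ}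
    {X' : Set ({a : α // a ≠ j} → ℝ)} {f' : ({a : α // a ≠ j} → ℝ) → (β → ℝ)}
    (h : graph X' f' = levelSlice (graph X f) i j b) :
    Realizes (e ∘ exchangeLabel i j) (S.erase (e (Sum.inl j))) (level F (e (Sum.inr i)) b) X' f' :=
  ⟨R.toIsLabeling.exchange i j b, by rw [h, R.levelSlice_eq]⟩

end Realizes

end Realization

section ChartOfMap

variable {α β γ : Type} {e : α ⊕ β → γ} {S : Finset γ} {F : Set (γ → ℝ)} {X : Set (α → ℝ)}
  {f : (α → ℝ) → (β → ℝ)} {L : FirstOrder.Language.{u, v}} [L.Structure ℝ]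

namespace Realizes

lemma extend_elim_fstPart (R : Realizes e S F X f) {z z₀ : γ → ℝ} (hz : z ∈ F) (hz₀ : z₀ ∈ F) :
    Function.extend e (Sum.elim (fstPart e z) (f (fstPart e z))) z₀ = z := by
  rw [R.elim_eq_comp hz]
  funext c
  by_cases hc : c ∈ range e
  · obtain ⟨d, rfl⟩ := hc
    exact R.injective.extend_apply _ _ _
  · rw [Function.extend_apply' _ _ _ hc]
    exact R.constant c hc z₀ hz₀ z hz

lemma exists_continuousOn_leftInvOn (R : Realizes e S F X f) (hX : X.Nonempty)
    (hf : ContinuousOn f X) :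
    ∃ g : (α → ℝ) → (γ → ℝ), ContinuousOn g X ∧ LeftInvOn g (fstPart e) F := by
  obtain ⟨z₀, hz₀⟩ := R.nonempty_iff.2 hX
  refine ⟨fun x => Function.extend e (Sum.elim x (f x)) z₀,
    (continuous_extend e z₀).comp_continuousOn ?_, fun z hz => R.extend_elim_fstPart hz hz₀⟩
  rw [continuousOn_pi]
  rintro (a | b)
  · exact (continuous_apply a).continuousOn
  · exact (continuous_apply b).comp_continuousOn hf

lemma isChart (R : Realizes e S F X f) (h : IsBoundedContinuousMap L X f) : IsChart S F := by
  classical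
  obtain ⟨g, hg, hgz⟩ := R.exists_continuousOn_leftInvOn h.nonempty h.continuous
  refine ⟨R.nonempty_iff.2 h.nonempty, R.separates, fun z hz U hU => ?_, fun J σ c hJ => ?_⟩
  · have hX : X ∈ 𝓝 (fstPart e z) := h.domain.isOpen.mem_nhds (R.fstPart_mem hz)
    have hU' : X ∩ g ⁻¹' U ∈ 𝓝 (fstPart e z) :=
      inter_mem hX ((hg.continuousAt hX).preimage_mem_nhds (by rwa [hgz hz]))
    filter_upwards [continuous_fstPart.continuousAt.preimage_mem_nhds hU'] with x ⟨hx, hxU⟩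
    obtain ⟨w, hw, hwx⟩ := R.exists_mem hx
    rw [mem_preimage, ← hwx, hgz hw] at hxU
    exact ⟨w, ⟨hw, hxU⟩, R.eqOn_iff.2 hwx⟩
  · obtain ⟨J, rfl⟩ : ∃ J' : Finset α, J'.image (e ∘ Sum.inl) = J := by
      obtain ⟨J', -, hJ'⟩ := Finset.subset_set_image_iff.1
        (show (J : Set γ) ⊆ (e ∘ Sum.inl) '' univ from fun c hc =>
          let ⟨a, ha⟩ := (R.mem_iff c).1 (hJ hc)
          ⟨a, mem_univ a, ha⟩)
      exact ⟨J', hJ'⟩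
    rw [← (hgz.mono inter_subset_left).image_image, R.image_inter_cone]
    exact (h.domain.connected _ ⟨J, _, _, rfl⟩).image g (hg.mono inter_subset_left)

lemma eventually_exists_fstPart_eq (R : Realizes e S F X f) (h : IsChart S F) {z : γ → ℝ}
    (hz : z ∈ F) {U : Set (γ → ℝ)} (hU : U ∈ 𝓝 z) :
    ∀ᶠ x in 𝓝 (fstPart e z), ∃ w ∈ F ∩ U, fstPart e w = x := by
  have hextend (x : α → ℝ) : fstPart e (Function.extend (e ∘ Sum.inl) x z) = x :=
    Function.extend_comp R.injective_comp_inl x z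
  filter_upwards [(continuous_extend (e ∘ Sum.inl) z).continuousAt.eventually
    (h.isOpenOver.eventually_exists hz (R.eqOn_iff.2 (hextend (fstPart e z)).symm) hU)]
    with x ⟨w, hw, hwx⟩
  exact ⟨w, hw, (R.eqOn_iff.1 hwx).trans (hextend x)⟩

lemma isOpen_domain (R : Realizes e S F X f) (h : IsChart S F) : IsOpen X := by
  rw [isOpen_iff_mem_nhds]
  intro x hx
  obtain ⟨z, hz, rfl⟩ := R.exists_mem hx
  filter_upwards [R.eventually_exists_fstPart_eq h hz univ_mem] with y ⟨w, hw, hwy⟩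
  exact hwy ▸ R.fstPart_mem hw.1

lemma continuousOn (R : Realizes e S F X f) (h : IsChart S F) : ContinuousOn f X := by
  intro x hx
  obtain ⟨z, hz, rfl⟩ := R.exists_mem hx
  refine ContinuousAt.continuousWithinAt fun W hW => mem_map.2 ?_
  rw [← R.sndPart_eq hz] at hW
  filter_upwards [R.eventually_exists_fstPart_eq h hz
    (continuous_sndPart.continuousAt.preimage_mem_nhds hW)] with y ⟨w, hw, hwy⟩
  rw [mem_preimage, ← hwy, ← R.sndPart_eq hw.1]
  exact hw.2

lemma isPreconnected_inter (R : Realizes e S F X f) (h : IsChart S F) {C : Set (α → ℝ)}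
    (hC : IsCoordinateCone C) : IsPreconnected (X ∩ C) := by
  classical
  obtain ⟨J, σ, c, rfl⟩ := hC
  have himage := R.image_inter_cone J (Function.extend (e ∘ Sum.inl) σ fun _ => Ordering.eq)
    (Function.extend (e ∘ Sum.inl) c 0)
  rw [Function.extend_comp R.injective_comp_inl, Function.extend_comp R.injective_comp_inl]
    at himage
  change IsPreconnected (X ∩ cone J σ c)
  rw [← himage]
  refine (h.connected _ _ _ fun k hk => ?_).image _ continuous_fstPart.continuousOn
  obtain ⟨a, -, rfl⟩ := Finset.mem_image.1 hk
  exact R.inl_mem a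

lemma isSemiMonotone [Finite α] [Finite γ] (R : Realizes e S F X f)
    (hdef : (univ : Set ℝ).Definable L F) (hbd : Bornology.IsBounded F) (h : IsChart S F) :
    IsSemiMonotone L X where
  definable := by
    rw [← R.image_fstPart]
    exact hdef.image_comp (e ∘ Sum.inl)
  isOpen := R.isOpen_domain h
  bounded := by
    rw [← R.image_fstPart]
    exact isBounded_image_comp hbd (e ∘ Sum.inl)
  connected _ := R.isPreconnected_inter h

lemma isBoundedContinuousMap [Finite α] [Finite β] [Finite γ] (R : Realizes e S F X f)
    (hdef : (univ : Set ℝ).Definable L F) (hbd : Bornology.IsBounded F) (h : IsChart S F) :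
    IsBoundedContinuousMap L X f where
  nonempty := R.nonempty_iff.1 h.nonempty
  domain := R.isSemiMonotone hdef hbd h
  definable := by
    rw [← R.image_eq]
    exact hdef.image_comp e
  continuous := R.continuousOn h
  bounded := by
    rw [← R.image_sndPart]
    exact isBounded_image_comp hbd (e ∘ Sum.inr)

end Realizes

end ChartOfMap

section MonotoneChartOfMap

variable {γ : Type} {S : Finset γ} {F : Set (γ → ℝ)} {G : Set (γ → ℝ)}

lemma isChart_empty (hG : G.Nonempty) (h : Separates ∅ G) : IsChart ∅ G where
  nonempty := hG
  separates := h
  isOpenOver z hz U hU := Eventually.of_forall fun x =>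
    ⟨z, ⟨hz, mem_of_mem_nhds hU⟩, by simp⟩
  connected J σ c _ := by
    have hsub : G.Subsingleton := fun z hz w hw => h z hz w hw (by simp)
    exact (hsub.anti inter_subset_left).isPreconnected

variable [DecidableEq γ]

lemma isMonotoneChart_empty (hG : G.Nonempty) (h : Separates ∅ G) : IsMonotoneChart ∅ G :=
  ⟨isChart_empty hG h, by simp, by simp⟩

variable {α β : Type} {e : α ⊕ β → γ} {X : Set (α → ℝ)} {f : (α → ℝ) → (β → ℝ)}
  {L : FirstOrder.Language.{u, v}} [L.Structure ℝ]

lemma Realizes.mem_basisSystem_iff (R : Realizes e S F X f) {H : Finset (α ⊕ β)} :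
    H ∈ basisSystem X f ↔ H.card = Nat.card α ∧ Separates (H.image e) F := by
  refine and_congr_right fun _ => ?_
  have heqOn {z w} (hz : z ∈ F) (hw : w ∈ F) : EqOn z w (H.image e) ↔
      (fun h : {c // c ∈ H} => Sum.elim (fstPart e z) (f (fstPart e z)) h.1) =
        fun h : {c // c ∈ H} => Sum.elim (fstPart e w) (f (fstPart e w)) h.1 := by
    rw [R.elim_eq_comp hz, R.elim_eq_comp hw, funext_iff, Subtype.forall]
    exact Finset.forall_mem_image
  constructor
  · exact fun h z hz w hw hzw => R.separates z hz w hw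
      (R.eqOn_iff.2 (h (R.fstPart_mem hz) (R.fstPart_mem hw) ((heqOn hz hw).1 hzw)))
  · intro h x hx y hy hxy
    obtain ⟨z, hz, rfl⟩ := R.exists_mem hx
    obtain ⟨w, hw, rfl⟩ := R.exists_mem hy
    rw [h z hz w hw ((heqOn hz hw).2 hxy)]

lemma Realizes.separates_of_basisSystem_eq {F₁ F₂ : Set (γ → ℝ)} {X₁ X₂ : Set (α → ℝ)}
    {f₁ f₂ : (α → ℝ) → (β → ℝ)} (R₁ : Realizes e S F₁ X₁ f₁) (R₂ : Realizes e S F₂ X₂ f₂)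
    (hF₁ : IsMonotoneChart S F₁) (heq : basisSystem X₁ f₁ = basisSystem X₂ f₂) {H : Finset γ}
    (hcard : H.card = S.card) (hH : Separates H F₁) : Separates H F₂ := by
  have hrange : (H : Set γ) ⊆ e '' univ := by
    rw [image_univ]
    exact R₁.subset_range fun c hc b hconst => hF₁.notMem_of_const hH hcard hconst hc
  obtain ⟨H, -, rfl⟩ := Finset.subset_set_image_iff.1 hrange
  rw [Finset.card_image_of_injective H R₁.injective, R₁.card_eq] at hcard
  exact (R₂.mem_basisSystem_iff.1 (heq ▸ R₁.mem_basisSystem_iff.2 ⟨hcard, hH⟩)).2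

lemma injOn_of_not_independentOf [Subsingleton α] {g : (α → ℝ) → ℝ} {j : α}
    (h : StrictlyIncreasingIn X g j ∨ StrictlyDecreasingIn X g j ∨ IndependentOf X g j)
    (hj : ¬ IndependentOf X g j) : InjOn g X := by
  have hoff (x y : α → ℝ) : AgreeOff j x y := fun l hl => absurd (Subsingleton.elim l j) hl
  intro x hx y hy hxy
  by_contra hne
  have hxyj : x j ≠ y j := fun hxyj => hne (funext fun l => Subsingleton.elim j l ▸ hxyj)
  rcases h with hinc | hdec | hind
  · rcases hxyj.lt_or_gt with hlt | hlt
    · exact (hinc x hx y hy (hoff x y) hlt).ne hxy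
    · exact (hinc y hy x hx (hoff y x) hlt).ne' hxy
  · rcases hxyj.lt_or_gt with hlt | hlt
    · exact (hdec x hx y hy (hoff x y) hlt).ne' hxy
    · exact (hdec y hy x hx (hoff y x) hlt).ne hxy
  · exact hj hind

lemma Realizes.isMonotoneChart_of_card_eq_one (R : Realizes e S F X f) (hα : Nat.card α = 1)
    (hb : IsBoundedContinuousMap L X f)
    (h : ∀ i, IsMonotoneFunction L X fun x => f x i) : IsMonotoneChart S F := by
  have hα' : Subsingleton α := (Nat.card_eq_one_iff_unique.1 hα).1
  have key {i j} (hi : i ∉ S) (hj : j ∈ S) (hij : VariesAlong S F i j) (b : ℝ) :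
      S.erase j = ∅ ∧ Separates ∅ (level F i b) := by
    obtain ⟨i, rfl⟩ := R.exists_inr_eq_of_variesAlong hi hij
    obtain ⟨j, rfl⟩ := (R.mem_iff j).1 hj
    refine ⟨by rw [← Finset.card_eq_zero, Finset.card_erase_of_mem hj, R.card_eq, hα], ?_⟩
    have hinj := injOn_of_not_independentOf ((h i).coordinates j) (R.variesAlong_iff.1 hij)
    exact separates_insert_iff.1 (R.separates_singleton_iff.2 hinj) b
  refine ⟨R.isChart hb, fun i hi j hj hij b hb => ?_, fun i hi j hj hij H _ b b' _ _ =>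
    (key hi hj hij b').2.superset H.empty_subset⟩
  obtain ⟨hempty, hsep⟩ := key hi hj hij b
  rw [hempty]
  exact isMonotoneChart_empty hb hsep

theorem Realizes.isMonotoneChart {n : ℕ} (R : Realizes e S F X f) (hα : Nat.card α = n + 1)
    (h : IsMonotoneMapOfDim L (n + 1) X f) : IsMonotoneChart S F := by
  induction n generalizing α S F X with
  | zero => exact R.isMonotoneChart_of_card_eq_one hα h.1 h.2
  | succ n ih =>
    obtain ⟨hb, hslice⟩ := h
    have hexchange {i j} (hi : i ∉ S) (hj : j ∈ S) (hij : VariesAlong S F i j) :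
        ∃ (i' : β) (j' : α) (m : Set (Finset ({a : α // a ≠ j'} ⊕ β))),
          ∀ b, (level F i b).Nonempty → ∃ X' f',
            Realizes (e ∘ exchangeLabel i' j') (S.erase j) (level F i b) X' f' ∧
            IsMonotoneChart (S.erase j) (level F i b) ∧ basisSystem X' f' = m := by
      obtain ⟨i, rfl⟩ := R.exists_inr_eq_of_variesAlong hi hij
      obtain ⟨j, rfl⟩ := (R.mem_iff j).1 hj
      obtain ⟨m, hm⟩ := hslice i j (R.variesAlong_iff.1 hij)
      refine ⟨i, j, m, fun b hne => ?_⟩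
      obtain ⟨X', f', hmono, hgraph, hbasis⟩ := hm b (by rw [R.levelSlice_eq]; exact hne.image _)
      have R' := R.exchange hgraph
      refine ⟨X', f', R', ih R' ?_ hmono, hbasis⟩
      rw [← R'.card_eq, Finset.card_erase_of_mem hj, R.card_eq, hα, Nat.add_sub_cancel]
    refine ⟨R.isChart hb, fun i hi j hj hij b hne => ?_,
      fun i hi j hj hij H hcard b b' hne hH => ?_⟩
    · obtain ⟨_, _, _, hlevel⟩ := hexchange hi hj hij
      obtain ⟨_, _, _, hmono, _⟩ := hlevel b hne
      exact hmono
    · obtain ⟨_, _, _, hlevel⟩ := hexchange hi hj hij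
      rcases (level F i b').eq_empty_or_nonempty with hempty | hne'
      · rw [hempty]
        exact fun _ hz => False.elim hz
      obtain ⟨_, _, R₁, hmono, hbasis₁⟩ := hlevel b hne
      obtain ⟨_, _, R₂, _, hbasis₂⟩ := hlevel b' hne'
      exact R₁.separates_of_basisSystem_eq R₂ hmono (hbasis₁.trans hbasis₂.symm) hcard hH

end MonotoneChartOfMap

section OneVariable

lemma strictMonoOn_or_strictAntiOn_of_injOn {s : Set ℝ} (hs : s.OrdConnected) {g : ℝ → ℝ}
    (hg : ContinuousOn g s) (hinj : InjOn g s) : StrictMonoOn g s ∨ StrictAntiOn g s := by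
  rcases s.eq_empty_or_nonempty with rfl | hne
  · exact Or.inl fun _ hx => False.elim hx
  obtain ⟨a, ha⟩ := hne
  have : Inhabited s := ⟨⟨a, ha⟩⟩
  exact (hg.domRestrict.strictMono_of_inj hinj.injective).imp strictMono_domRestrict.1
    strictAntiOn_iff_strictAnti.2

variable {α β : Type} {X : Set (α → ℝ)} {L : FirstOrder.Language.{u, v}} [L.Structure ℝ]

lemma definable_setOf_lt (hlt : (univ : Set ℝ).Definable₂ L {p : ℝ × ℝ | p.1 < p.2})
    {f g : (α → ℝ) → ℝ} (hf : (univ : Set ℝ).DefinableFun L f)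
    (hg : (univ : Set ℝ).DefinableFun L g) :
    (univ : Set ℝ).Definable L {x : α → ℝ | f x < g x} := by
  have hfg : (univ : Set ℝ).DefinableMap L fun x => ![f x, g x] := by
    simp [DefinableMap, *]
  exact hlt.preimage_map hfg

lemma ordConnected_cone (J : Finset α) (σ : α → Ordering) (c : α → ℝ) :
    (cone J σ c).OrdConnected := by
  have hcone : cone J σ c = ⋂ j ∈ J, Function.eval j ⁻¹' {t | (σ j).Compares t (c j)} := by
    ext x
    simp [cone]
  rw [hcone]
  exact ordConnected_biInter fun j _ =>
    (ordConnected_setOf_compares (σ j) (c j)).preimage_mono (Function.monotone_eval j)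

lemma IsSemiMonotone.isPreconnected (h : IsSemiMonotone L X) : IsPreconnected X := by
  have hcone : IsCoordinateCone (univ : Set (α → ℝ)) := ⟨∅, fun _ => Ordering.eq, 0, by simp⟩
  simpa only [inter_univ] using h.connected univ hcone

lemma IsBoundedContinuousMap.definable_inter_preimage [Finite α] [Finite β]
    {f : (α → ℝ) → (β → ℝ)} (h : IsBoundedContinuousMap L X f) {i : β} {T : Set ℝ}
    (hT : (univ : Set ℝ).Definable L {z : α ⊕ β → ℝ | z (Sum.inr i) ∈ T}) :
    (univ : Set ℝ).Definable L {x | x ∈ X ∧ f x i ∈ T} := by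
  convert (h.definable.inter hT).image_comp (Sum.inl : α → α ⊕ β) using 1
  ext x
  constructor
  · rintro ⟨hx, hxT⟩
    exact ⟨Sum.elim x (f x), ⟨⟨hx, rfl⟩, hxT⟩, rfl⟩
  · rintro ⟨z, ⟨⟨hz, hzf⟩, hzT⟩, rfl⟩
    exact ⟨hz, congrFun hzf i ▸ hzT⟩

lemma IsBoundedContinuousMap.definable_graph_apply [Finite α] [Finite β]
    {f : (α → ℝ) → (β → ℝ)} (h : IsBoundedContinuousMap L X f) (i : β) :
    (univ : Set ℝ).Definable L (graph X fun x (_ : Unit) => f x i) := by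
  convert h.definable.image_comp (Sum.map id fun _ : Unit => i) using 1
  ext y
  constructor
  · rintro ⟨hx, hy⟩
    refine ⟨Sum.elim (y ∘ Sum.inl) (f (y ∘ Sum.inl)), ⟨hx, rfl⟩, ?_⟩
    ext (a | _)
    exacts [rfl, (congrFun hy ()).symm]
  · rintro ⟨z, ⟨hz, hzf⟩, rfl⟩
    exact ⟨hz, funext fun _ => congrFun hzf i⟩

variable [Unique α]

lemma isPreconnected_iff_ordConnected_of_unique : IsPreconnected X ↔ X.OrdConnected := by
  rw [← (Homeomorph.funUnique α ℝ).isPreconnected_image, isPreconnected_iff_ordConnected]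
  refine ⟨fun h => ?_, fun h => ordConnected_image (OrderIso.funUnique α ℝ)⟩
  rw [← (OrderIso.funUnique α ℝ).injective.preimage_image X]
  exact h.preimage_mono (OrderIso.funUnique α ℝ).monotone

lemma agreeOff_default (x y : α → ℝ) : AgreeOff default x y := fun l hl =>
  absurd (Unique.eq_default l) hl

lemma isSubmonotone_of_unique {g : (α → ℝ) → ℝ} (hne : X.Nonempty) (hX : IsSemiMonotone L X)
    (hbd : Bornology.IsBounded (g '' X)) (hg : ContinuousOn g X)
    (hdef : ∀ b, (univ : Set ℝ).Definable L {x | x ∈ X ∧ g x < b})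
    (hmono : MonotoneOn g X ∨ AntitoneOn g X) : IsSubmonotone L X g where
  nonempty := hne
  domain := hX
  bounded := hbd
  upperSemicontinuous := hg.upperSemicontinuousOn
  sublevel b :=
    { definable := hdef b
      isOpen := hg.isOpen_inter_preimage hX.isOpen isOpen_Iio
      bounded := hX.bounded.subset (sep_subset X _)
      connected := by
        rintro C ⟨J, σ, c, rfl⟩
        have hXord := isPreconnected_iff_ordConnected_of_unique.1 hX.isPreconnected
        have hsub : (X ∩ g ⁻¹' Iio b).OrdConnected := by
          obtain ⟨u, hu, hXu⟩ := hmono.elim (ordConnected_Iio (a := b)).preimage_monotoneOn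
            ordConnected_Iio.preimage_antitoneOn
          exact hXu ▸ hXord.inter hu
        exact isPreconnected_iff_ordConnected_of_unique.2 (hsub.inter (ordConnected_cone J σ c)) }

lemma strictlyIncreasingIn_or_strictlyDecreasingIn_of_injOn {g : (α → ℝ) → ℝ}
    (hX : IsPreconnected X) (hg : ContinuousOn g X) (hinj : InjOn g X) :
    StrictlyIncreasingIn X g default ∨ StrictlyDecreasingIn X g default := by
  set φ := Homeomorph.funUnique α ℝ
  have hmaps : MapsTo φ.symm (φ '' X) X := by
    rintro _ ⟨x, hx, rfl⟩
    rwa [φ.symm_apply_apply]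
  have key := strictMonoOn_or_strictAntiOn_of_injOn
    (φ.isPreconnected_image.2 hX).ordConnected
    (hg.comp φ.symm.continuous.continuousOn hmaps) (hinj.comp φ.symm.injective.injOn hmaps)
  refine key.imp (fun h x hx y hy _ hxy => ?_) fun h x hx y hy _ hxy => ?_ <;>
  · have := h (mem_image_of_mem φ hx) (mem_image_of_mem φ hy) hxy
    simpa only [Function.comp_apply, φ.symm_apply_apply] using this

lemma monotoneOn_or_antitoneOn_of_unique {g : (α → ℝ) → ℝ}
    (h : StrictlyIncreasingIn X g default ∨ StrictlyDecreasingIn X g default ∨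
      IndependentOf X g default) : MonotoneOn g X ∨ AntitoneOn g X := by
  have lt_of_le_of_ne {x y : α → ℝ} (hxy : x ≤ y) (hne : x ≠ y) : x default < y default :=
    (OrderIso.funUnique α ℝ).lt_iff_lt.2 (hxy.lt_of_ne hne)
  rcases h with hinc | hdec | hind
  · refine Or.inl fun x hx y hy hxy => ?_
    rcases eq_or_ne x y with rfl | hne
    exacts [le_rfl, (hinc x hx y hy (agreeOff_default x y) (lt_of_le_of_ne hxy hne)).le]
  · refine Or.inr fun x hx y hy hxy => ?_
    rcases eq_or_ne x y with rfl | hne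
    exacts [le_rfl, (hdec x hx y hy (agreeOff_default x y) (lt_of_le_of_ne hxy hne)).le]
  · exact Or.inl fun x hx y hy _ => (hind x hx y hy (agreeOff_default x y)).le

theorem IsBoundedContinuousMap.isMonotoneFunction_of_unique [Finite β]
    (hlt : (univ : Set ℝ).Definable₂ L {p : ℝ × ℝ | p.1 < p.2}) {f : (α → ℝ) → (β → ℝ)}
    (h : IsBoundedContinuousMap L X f) {i : β}
    (hi : IndependentOf X (fun x => f x i) default ∨ InjOn (fun x => f x i) X) :
    IsMonotoneFunction L X fun x => f x i := by
  have hcont : ContinuousOn (fun x => f x i) X :=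
    (continuous_apply i).comp_continuousOn h.continuous
  have hbd : Bornology.IsBounded ((fun x => f x i) '' X) := by
    simpa only [image_image] using Bornology.IsBounded.image_eval h.bounded i
  have hbd_neg : Bornology.IsBounded ((fun x => - f x i) '' X) := by
    simpa only [← image_neg_eq_neg, image_image] using hbd.neg
  have hcoord : StrictlyIncreasingIn X (fun x => f x i) default ∨
      StrictlyDecreasingIn X (fun x => f x i) default ∨
      IndependentOf X (fun x => f x i) default := by
    rw [← or_assoc]
    exact hi.symm.imp_left
      (strictlyIncreasingIn_or_strictlyDecreasingIn_of_injOn h.domain.isPreconnected hcont)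
  have hmono := monotoneOn_or_antitoneOn_of_unique hcoord
  refine ⟨h.definable_graph_apply i, ?_, ?_, fun j => Unique.eq_default j ▸ hcoord⟩
  · exact isSubmonotone_of_unique h.nonempty h.domain hbd hcont
      (fun b => h.definable_inter_preimage (T := Iio b)
        (definable_setOf_lt hlt (by fun_prop) (L.definableFun_const _ (mem_univ b)))) hmono
  · refine isSubmonotone_of_unique h.nonempty h.domain hbd_neg hcont.neg (fun b => ?_)
      (hmono.symm.imp AntitoneOn.neg MonotoneOn.neg)
    simp only [neg_lt]
    exact h.definable_inter_preimage (T := Ioi (-b))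
      (definable_setOf_lt hlt (L.definableFun_const _ (mem_univ (-b))) (by fun_prop))

end OneVariable

section MapOfMonotoneChart

variable {L : FirstOrder.Language.{u, v}} [L.Structure ℝ]

lemma IsMonotoneMapOfDim.isBoundedContinuousMap {α β : Type} {X : Set (α → ℝ)}
    {f : (α → ℝ) → (β → ℝ)} {n : ℕ} (h : IsMonotoneMapOfDim L n X f) :
    IsBoundedContinuousMap L X f :=
  match n, h with
  | 1, h => h.1
  | _ + 2, h => h.1

lemma IsBoundedContinuousMap.isBounded_graph {α β : Type} {X : Set (α → ℝ)}
    {f : (α → ℝ) → (β → ℝ)} (h : IsBoundedContinuousMap L X f) :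
    Bornology.IsBounded (graph X f) := by
  rw [← Bornology.forall_isBounded_image_eval_iff]
  rintro (a | b)
  · refine (Bornology.IsBounded.image_eval h.domain.bounded a).subset ?_
    rintro _ ⟨z, hz, rfl⟩
    exact ⟨_, hz.1, rfl⟩
  · refine (Bornology.IsBounded.image_eval h.bounded b).subset ?_
    rintro _ ⟨z, hz, rfl⟩
    exact ⟨_, ⟨_, hz.1, rfl⟩, congrFun hz.2.symm b⟩

variable {β γ : Type} [DecidableEq γ] {F : Set (γ → ℝ)}

lemma Realizes.isMonotoneFunction [Finite β] {α : Type} [Unique α] {e : α ⊕ β → γ} {S : Finset γ}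
    {X : Set (α → ℝ)} {f : (α → ℝ) → (β → ℝ)} (R : Realizes e S F X f)
    (hlt : (univ : Set ℝ).Definable₂ L {p : ℝ × ℝ | p.1 < p.2})
    (hb : IsBoundedContinuousMap L X f) (h : IsMonotoneChart S F) (i : β) :
    IsMonotoneFunction L X fun x => f x i := by
  refine hb.isMonotoneFunction_of_unique hlt
    (or_iff_not_imp_left.2 fun hind => R.separates_singleton_iff.1 ?_)
  have hempty : S.erase (e (Sum.inl default)) = ∅ := by
    rw [← Finset.card_eq_zero, Finset.card_erase_of_mem (R.inl_mem _), R.card_eq, Nat.card_unique]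
  rw [← insert_empty_eq, ← hempty]
  exact h.separates_exchange (R.inl_mem default) (R.variesAlong_iff.2 hind)

lemma Realizes.basisSystem_level_eq {α : Type} {e : α ⊕ β → γ} {S : Finset γ} {X : Set (α → ℝ)}
    {f : (α → ℝ) → (β → ℝ)} (R : Realizes e S F X f) (h : IsMonotoneChart S F) {i : β} {j : α}
    (hij : VariesAlong S F (e (Sum.inr i)) (e (Sum.inl j))) {b : ℝ}
    {X' : Set ({a : α // a ≠ j} → ℝ)} {f' : ({a : α // a ≠ j} → ℝ) → (β → ℝ)}
    (R' : Realizes (e ∘ exchangeLabel i j) (S.erase (e (Sum.inl j)))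
      (level F (e (Sum.inr i)) b) X' f') (hb : (level F (e (Sum.inr i)) b).Nonempty) :
    basisSystem X' f' = {H | H.card = Nat.card {a : α // a ≠ j} ∧
      ∀ b', Separates (H.image (e ∘ exchangeLabel i j)) (level F (e (Sum.inr i)) b')} := by
  ext H
  rw [R'.mem_basisSystem_iff]
  refine and_congr_right fun hH => ⟨fun hsep b' => ?_, fun hsep => hsep b⟩
  refine h.separates_level_of_notMem (R.inr_notMem i) (R.inl_mem j) hij ?_ hb hsep b'
  rw [Finset.card_image_of_injective _ R'.injective, hH, R'.card_eq]

theorem Realizes.isMonotoneMapOfDim [Finite β] [Finite γ]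
    (hlt : (univ : Set ℝ).Definable₂ L {p : ℝ × ℝ | p.1 < p.2}) {n : ℕ} {α : Type} [Finite α]
    {e : α ⊕ β → γ} {S : Finset γ} {X : Set (α → ℝ)} {f : (α → ℝ) → (β → ℝ)}
    (R : Realizes e S F X f) (hα : Nat.card α = n + 1) (hdef : (univ : Set ℝ).Definable L F)
    (hbd : Bornology.IsBounded F) (h : IsMonotoneChart S F) :
    IsMonotoneMapOfDim L (n + 1) X f := by
  have hb := R.isBoundedContinuousMap hdef hbd h.isChart
  induction n generalizing α S F X f with
  | zero =>
    have := (Nat.card_eq_one_iff_unique.1 hα).1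
    have := uniqueOfSubsingleton (Nat.card_eq_one_iff_unique.1 hα).2.some
    exact ⟨hb, fun i => R.isMonotoneFunction hlt hb h i⟩
  | succ n ih =>
    refine ⟨hb, fun i j hind => ⟨{H | H.card = Nat.card {a // a ≠ j} ∧
      ∀ b, Separates (H.image (e ∘ exchangeLabel i j)) (level F (e (Sum.inr i)) b)},
      fun b hne => ?_⟩⟩
    have hij := R.variesAlong_iff.2 hind
    rw [R.levelSlice_eq, image_nonempty] at hne
    have hlevel := h.level_of_notMem (R.inr_notMem i) (R.inl_mem j) hij hne
    obtain ⟨f', R'⟩ := (R.toIsLabeling.exchange i j b).exists_realizes hlevel.isChart.separates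
    have hcard : Nat.card {a // a ≠ j} = n + 1 := by
      rw [← R'.card_eq, Finset.card_erase_of_mem (R.inl_mem j), R.card_eq, hα, Nat.add_sub_cancel]
    have hdef' : (univ : Set ℝ).Definable L (level F (e (Sum.inr i)) b) :=
      hdef.inter (DefinableFun.ofPred_eq_const (DefinableFun.proj L) (mem_univ b))
    have hbd' := hbd.subset (level_subset F (e (Sum.inr i)) b)
    refine ⟨_, f', ih R' hcard hdef' hbd' hlevel
      (R'.isBoundedContinuousMap hdef' hbd' hlevel.isChart), ?_,
      R.basisSystem_level_eq h hij R' hne⟩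
    rw [R.levelSlice_eq]
    exact R'.image_eq.symm

end MapOfMonotoneChart

section Graph

variable {α β γ : Type}

lemma realizes_graph [Fintype α] [DecidableEq (α ⊕ β)] (X : Set (α → ℝ))
    (f : (α → ℝ) → (β → ℝ)) :
    Realizes id (Finset.univ.image Sum.inl) (graph X f) X f where
  injective := Function.injective_id
  mem_iff := by simp
  constant c hc := absurd ⟨c, rfl⟩ hc
  image_eq := by simp

/-- The naming of the coordinates by which the projection to `span H` becomes `fstPart`. -/
def splitLabel (H : Finset γ) : {c // c ∈ H} ⊕ {c // c ∉ H} → γ :=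
  Sum.elim Subtype.val Subtype.val

lemma splitLabel_surjective (H : Finset γ) : Function.Surjective (splitLabel H) := fun c => by
  by_cases hc : c ∈ H
  exacts [⟨Sum.inl ⟨c, hc⟩, rfl⟩, ⟨Sum.inr ⟨c, hc⟩, rfl⟩]

lemma isLabeling_splitLabel (H : Finset γ) (F : Set (γ → ℝ)) :
    IsLabeling (splitLabel H) H F where
  injective := Subtype.val_injective.sumElim Subtype.val_injective fun a b h => b.2 (h ▸ a.2)
  mem_iff c := ⟨fun hc => ⟨⟨c, hc⟩, rfl⟩, fun ⟨a, ha⟩ => ha ▸ a.2⟩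
  constant c hc := absurd (splitLabel_surjective H c) hc

lemma Realizes.eq_setOf_of_surjective {e : α ⊕ β → γ} {S : Finset γ} {F : Set (γ → ℝ)}
    {X : Set (α → ℝ)} {f : (α → ℝ) → (β → ℝ)} (R : Realizes e S F X f)
    (he : Function.Surjective e) : F = {z | fstPart e z ∈ X ∧ sndPart e z = f (fstPart e z)} := by
  have hpre : F = (fun z => z ∘ e) ⁻¹' graph X f := by
    rw [← R.image_eq, he.injective_comp_right.preimage_image]
  exact hpre

end Graph

end MonotoneMaps

open MonotoneMaps in
theorem theorem3p10_general {L : FirstOrder.Language.{u, v}} [L.Structure ℝ]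
    (hlt : (Set.univ : Set ℝ).Definable₂ L {p : ℝ × ℝ | p.1 < p.2})
    {α β : Type} [Finite β] {X : Set (α → ℝ)} {f : (α → ℝ) → (β → ℝ)} (hf : IsMonotoneMap L X f)
    {H : Finset (α ⊕ β)} (hH : H ∈ basisSystem X f) :
    IsSemiMonotone L (proj H (graph X f)) ∧
    ∃ g : ({c // c ∈ H} → ℝ) → ({c // c ∉ H} → ℝ),
      IsMonotoneMap L (proj H (graph X f)) g ∧
      graph X f = {z : α ⊕ β → ℝ | (fun c : {c // c ∈ H} => z c.1) ∈ proj H (graph X f) ∧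
        (fun c : {c // c ∉ H} => z c.1) = g (fun c : {c // c ∈ H} => z c.1)} := by
  classical
  obtain ⟨n, hn⟩ : ∃ n, Nat.card α = n + 1 :=
    Nat.exists_eq_succ_of_ne_zero fun h => by simp [IsMonotoneMap, h, IsMonotoneMapOfDim] at hf
  have : Finite α := Nat.finite_of_card_ne_zero (by simp [hn])
  have := Fintype.ofFinite α
  rw [IsMonotoneMap, hn] at hf
  have hb := hf.isBoundedContinuousMap
  have R := realizes_graph X f
  obtain ⟨hcard, hsep⟩ := R.mem_basisSystem_iff.1 hH
  rw [Finset.image_id] at hsep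
  have hchart : IsMonotoneChart H (graph X f) :=
    (R.isMonotoneChart hn hf).of_separates hsep (hcard.trans R.card_eq.symm)
  obtain ⟨g, R'⟩ := (isLabeling_splitLabel H (graph X f)).exists_realizes hsep
  have hcardH : Nat.card {c // c ∈ H} = n + 1 := by rw [← R'.card_eq, hcard, hn]
  refine ⟨R'.isSemiMonotone hb.definable hb.isBounded_graph hchart.isChart, g, ?_,
    R'.eq_setOf_of_surjective (splitLabel_surjective H)⟩
  rw [IsMonotoneMap, hcardH]
  exact R'.isMonotoneMapOfDim hlt hcardH hb.definable hb.isBounded_graph hchart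

theorem theorem3p10 (L : FirstOrder.Language.{u, v}) [L.Structure ℝ]
    (hL : MonotoneMaps.IsOMinimal L) (n k : ℕ)
    (X : Set (Fin n → ℝ)) (f : (Fin n → ℝ) → (Fin k → ℝ))
    (hf : MonotoneMaps.IsMonotoneMap L X f)
    (H : Finset (Fin n ⊕ Fin k)) (hH : H ∈ MonotoneMaps.basisSystem X f) :
    MonotoneMaps.IsSemiMonotone L (MonotoneMaps.proj H (MonotoneMaps.graph X f)) ∧
    ∃ g : ({c // c ∈ H} → ℝ) → ({c // c ∉ H} → ℝ),
      MonotoneMaps.IsMonotoneMap L (MonotoneMaps.proj H (MonotoneMaps.graph X f)) g ∧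
      MonotoneMaps.graph X f =
        {z : Fin n ⊕ Fin k → ℝ |
          (fun c : {c // c ∈ H} => z c.1) ∈ MonotoneMaps.proj H (MonotoneMaps.graph X f) ∧
          (fun c : {c // c ∉ H} => z c.1) = g (fun c : {c // c ∈ H} => z c.1)} :=
  theorem3p10_general hL.definable_lt hf hH
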